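/- **Setting.** On Minkowski space $\mathbb R^{1,3}$ with coordinates $x=(x^0,\vec x)=(t,\vec x)$ and metric $g=\mathrm{diag}(-1,1,1,1)$, call a vector causal if it is nonzero and $g_{\mu\nu}v^\mu v^\nu\le 0$, let $J$ be the set of causal vectors, and call a function space-compact if its support is contained in $K+J$ for some compact $K$. Let $\mathcal Y_{\widetilde{\rm Max}}$ be the real vector space of smooth space-compact $\zeta=(\zeta_\mu):\mathbb R^{1,3}\to\mathbb R^4$ solving the Maxwell equation $$-\partial^\mu(\partial_\mu\zeta_\nu-\partial_\nu\zeta_\mu)=0 .$$ For $\zeta_1,\zeta_2\in\mathcal Y_{\widetilde{\rm Max}}$ put $$j^\mu(\zeta_1,\zeta_2,x)=\big(\partial^\mu\zeta_{1\nu}-\partial_\nu\zeta_1^\mu\big)\zeta_2^\nu-\zeta_{1\nu}\big(\partial^\mu\zeta_2^\nu-\partial^\nu\zeta_2^\mu\big),$$ $$\zeta_1\,\omega_{\widetilde{\rm Max}}\,\zeta_2=\int_{\mathbb R^3} j^0(\zeta_1,\zeta_2,(t,\vec x))\,d\vec x =\int_{\mathbb R^3}\Big(-\big(\dot{\vec\zeta}_1-\vec\partial\zeta_{10}\big)\cdot\vec\zeta_2+\vec\zeta_1\cdot\big(\dot{\vec\zeta}_2-\vec\partial\zeta_{20}\big)\Big)(t,\vec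 x)\,d\vec x .$$ For $\zeta\in\mathcal Y_{\widetilde{\rm Max}}$ let $$\chi_\zeta(t,\vec x)=-(-\Delta)^{-1}{\rm div}\,\vec\zeta(t,\vec x)=-\int_{\mathbb R^3}\frac{{\rm div}\,\vec\zeta(t,\vec y)}{4\pi|\vec x-\vec y|}\,d\vec y,\qquad \zeta^{\rm Coul}_\mu=\zeta_\mu-\partial_\mu\chi_\zeta .$$ Two 4-potentials are gauge equivalent if their difference is $\partial\chi=(\partial_\mu\chi)_\mu$ for some $\chi\in C^\infty(\mathbb R^{1,3},\mathbb R)$, not necessarily space-compact. **Proposition.** The bilinear form $\omega_{\widetilde{\rm Max}}$ does not depend on the time $t$ used to compute it. For every $\zeta\in\mathcal Y_{\widetilde{\rm Max}}$ the function $\chi_\zeta$ is smooth, and $\zeta^{\rm Coul}$ is a solution of the Maxwell equation, gauge equivalent to $\zeta$, in the Coulomb gauge: $\zeta^{\rm Coul}_0=0$ and ${\rm div}\,\vec\zeta^{\rm Coul}=0$. Moreover, for every $\zeta\in\mathcal Y_{\widetilde{\rm Max}}$ the following conditions are equivalent: 1. $\zeta\in{\rm Ker}\,\omega_{\widetilde{\rm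 Max}}$, that is, $\zeta\,\omega_{\widetilde{\rm Max}}\,\xi=0$ for all $\xi\in\mathcal Y_{\widetilde{\rm Max}}$; 2. $\zeta^{\rm Coul}=0$; 3. $\zeta=\partial\chi$ for some $\chi\in C^\infty(\mathbb R^{1,3},\mathbb R)$. Consequently the reduced space $\mathcal Y_{\rm Max}:=\mathcal Y_{\widetilde{\rm Max}}/{\rm Ker}\,\omega_{\widetilde{\rm Max}}$ is the space of gauge classes: $\zeta_1,\zeta_2\in\mathcal Y_{\widetilde{\rm Max}}$ define the same element of $\mathcal Y_{\rm Max}$ if and only if they are gauge equivalent. -/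

import Mathlib

open MeasureTheory
open scoped ContDiff Pointwise

noncomputable section

namespace Maxwell

/-! ### Minkowski space -/

/-- Minkowski space `ℝ^{1,3}` with coordinates `x^μ`, `μ = 0, 1, 2, 3`; `x^0` is the time. -/
abbrev Spacetime := Fin 4 → ℝ

/-- Physical space `ℝ³` with its Euclidean norm and Lebesgue measure. -/
abbrev Space := EuclideanSpace ℝ (Fin 3)

/-- The event `(t, x)`. -/
def event (t : ℝ) (x : Space) : Spacetime := Fin.cons t (fun i => x i)

/-- The projection of an event on its spatial part. -/
def spatial (x : Spacetime) : Space := WithLp.toLp 2 (fun i => x i.succ)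

/-- The diagonal entries `g_{μμ} = g^{μμ}` of the diagonal metric of signature `(-+++)`.
Raising or lowering the index `μ` is multiplication by `metric μ`. -/
def metric (μ : Fin 4) : ℝ := if μ = 0 then -1 else 1

/-- The set `J` of nonzero causal vectors (future or past oriented). -/
def causalVectors : Set Spacetime := {v | v ≠ 0 ∧ ∑ μ, metric μ * v μ ^ 2 ≤ 0}

/-- The causal shadow `J(O) = O + J`. -/
def causalShadow (O : Set Spacetime) : Set Spacetime := O + causalVectors

/-- A function on Minkowski space is space-compact if its (closed) support is contained in the
causal shadow of a compact set. -/
def IsSpaceCompact {E : Type*} [Zero E] (f : Spacetime → E) : Prop :=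
  ∃ K : Set Spacetime, IsCompact K ∧ tsupport f ⊆ causalShadow K

/-- The partial derivative `∂_μ f`. -/
def pd (μ : Fin 4) (f : Spacetime → ℝ) (x : Spacetime) : ℝ := fderiv ℝ f x (Pi.single μ 1)

/-! ### The Maxwell equation

A 4-potential `ζ` is given by its components with lower index, `ζ x μ = ζ_μ(x)`. -/

/-- `F_{μν} = ∂_μ ζ_ν - ∂_ν ζ_μ`. -/
def fieldTensor (ζ : Spacetime → Fin 4 → ℝ) (μ ν : Fin 4) (x : Spacetime) : ℝ :=
  pd μ (fun y => ζ y ν) x - pd ν (fun y => ζ y μ) x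

/-- The Maxwell equation `-∂^μ (∂_μ ζ_ν - ∂_ν ζ_μ) = 0`. -/
def SolvesMaxwell (ζ : Spacetime → Fin 4 → ℝ) : Prop :=
  ∀ (ν : Fin 4) (x : Spacetime), -∑ μ, metric μ * pd μ (fieldTensor ζ μ ν) x = 0

/-- The gradient `(∂χ)_μ = ∂_μ χ`. -/
def gradient (χ : Spacetime → ℝ) : Spacetime → Fin 4 → ℝ := fun x μ => pd μ χ x

/-- `ζ₁` and `ζ₂` are gauge equivalent: `ζ₁ = ζ₂ + ∂χ` for a smooth function `χ` on Minkowski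
space (which need not be space-compact). -/
def GaugeEquivalent (ζ₁ ζ₂ : Spacetime → Fin 4 → ℝ) : Prop :=
  ∃ χ : Spacetime → ℝ, ContDiff ℝ ∞ χ ∧ ζ₁ = ζ₂ + gradient χ

/-- The 4-current
`j^μ = (∂^μ ζ_{1ν} - ∂_ν ζ_1^μ) ζ_2^ν - ζ_{1ν} (∂^μ ζ_2^ν - ∂^ν ζ_2^μ)`. -/
def current (ζ₁ ζ₂ : Spacetime → Fin 4 → ℝ) (μ : Fin 4) (x : Spacetime) : ℝ :=
  ∑ ν, ((metric μ * fieldTensor ζ₁ μ ν x) * (metric ν * ζ₂ x ν)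
    - ζ₁ x ν * (metric μ * metric ν * fieldTensor ζ₂ μ ν x))

/-- The flux of the current through the Cauchy surface `x^0 = t`. -/
def flux (t : ℝ) (ζ₁ ζ₂ : Spacetime → Fin 4 → ℝ) : ℝ :=
  ∫ x : Space, current ζ₁ ζ₂ 0 (event t x)

/-- The explicit form of the time component of the current:
`-(∂_t ζ₁ - ∂ ζ_{10}) · ζ₂ + ζ₁ · (∂_t ζ₂ - ∂ ζ_{20})` in terms of the spatial parts. -/
theorem current_zero (ζ₁ ζ₂ : Spacetime → Fin 4 → ℝ) (x : Spacetime) :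
    current ζ₁ ζ₂ 0 x = ∑ i : Fin 3,
      (-(pd 0 (fun y => ζ₁ y i.succ) x - pd i.succ (fun y => ζ₁ y 0) x) * ζ₂ x i.succ
        + ζ₁ x i.succ * (pd 0 (fun y => ζ₂ y i.succ) x - pd i.succ (fun y => ζ₂ y 0) x)) := by
  rw [current, Fin.sum_univ_succ]
  simp only [metric, fieldTensor, Fin.succ_ne_zero, if_true, if_false, sub_self]
  rw [mul_zero, mul_zero, zero_mul, mul_zero, sub_zero, zero_add]
  refine Finset.sum_congr rfl fun i _ => ?_
  ring

/-! ### Helper facts for the space of solutions -/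

theorem contDiff_component {ζ : Spacetime → Fin 4 → ℝ} (h : ContDiff ℝ ∞ ζ) (ν : Fin 4) :
    ContDiff ℝ ∞ (fun y => ζ y ν) := contDiff_pi.1 h ν

theorem contDiff_pd {f : Spacetime → ℝ} (h : ContDiff ℝ ∞ f) (μ : Fin 4) :
    ContDiff ℝ ∞ (pd μ f) :=
  (h.fderiv_right (m := ∞) (by simp)).clm_apply contDiff_const

theorem pd_add {f g : Spacetime → ℝ} (hf : ContDiff ℝ ∞ f) (hg : ContDiff ℝ ∞ g) (μ : Fin 4) :
    pd μ (fun y => f y + g y) = fun x => pd μ f x + pd μ g x := by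
  funext x
  have := fderiv_fun_add (hf.differentiable (by simp) x) (hg.differentiable (by simp) x)
  simp [pd, this]

theorem pd_smul (c : ℝ) {f : Spacetime → ℝ} (hf : ContDiff ℝ ∞ f) (μ : Fin 4) :
    pd μ (fun y => c * f y) = fun x => c * pd μ f x := by
  funext x
  have := fderiv_const_mul (hf.differentiable (by simp) x) c
  simp [pd, this]

theorem contDiff_fieldTensor {ζ : Spacetime → Fin 4 → ℝ} (h : ContDiff ℝ ∞ ζ) (μ ν : Fin 4) :
    ContDiff ℝ ∞ (fieldTensor ζ μ ν) :=
  (contDiff_pd (contDiff_component h ν) μ).sub (contDiff_pd (contDiff_component h μ) ν)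

theorem fieldTensor_add {ζ ξ : Spacetime → Fin 4 → ℝ} (hζ : ContDiff ℝ ∞ ζ)
    (hξ : ContDiff ℝ ∞ ξ) (μ ν : Fin 4) :
    fieldTensor (ζ + ξ) μ ν = fun x => fieldTensor ζ μ ν x + fieldTensor ξ μ ν x := by
  funext x
  simp only [fieldTensor, Pi.add_apply,
    pd_add (contDiff_component hζ _) (contDiff_component hξ _)]
  ring

theorem fieldTensor_smul (c : ℝ) {ζ : Spacetime → Fin 4 → ℝ} (hζ : ContDiff ℝ ∞ ζ)
    (μ ν : Fin 4) :
    fieldTensor (c • ζ) μ ν = fun x => c * fieldTensor ζ μ ν x := by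
  funext x
  simp only [fieldTensor, Pi.smul_apply, smul_eq_mul, pd_smul c (contDiff_component hζ _)]
  ring

theorem IsSpaceCompact.add {ζ ξ : Spacetime → Fin 4 → ℝ} (hζ : IsSpaceCompact ζ)
    (hξ : IsSpaceCompact ξ) : IsSpaceCompact (ζ + ξ) := by
  obtain ⟨K, hK, h⟩ := hζ
  obtain ⟨L, hL, h'⟩ := hξ
  refine ⟨K ∪ L, hK.union hL, (tsupport_add ζ ξ).trans ?_⟩
  rw [causalShadow, Set.union_add]
  exact Set.union_subset_union h h'

theorem IsSpaceCompact.smul (c : ℝ) {ζ : Spacetime → Fin 4 → ℝ} (hζ : IsSpaceCompact ζ) :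
    IsSpaceCompact (c • ζ) := by
  obtain ⟨K, hK, h⟩ := hζ
  refine ⟨K, hK, (closure_mono ?_).trans h⟩
  exact Function.support_const_smul_subset c ζ

/-- The space of smooth real space-compact solutions of the Maxwell equation. -/
def solutionSpace : Submodule ℝ (Spacetime → Fin 4 → ℝ) where
  carrier := {ζ | ContDiff ℝ ∞ ζ ∧ IsSpaceCompact ζ ∧ SolvesMaxwell ζ}
  zero_mem' := by
    refine ⟨contDiff_const, ⟨∅, isCompact_empty, by simp [tsupport]⟩, fun ν x => ?_⟩
    have h0 : ∀ μ : Fin 4, pd μ (fun _ => (0 : ℝ)) = fun _ => 0 := fun μ => by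
      funext y; simp [pd]
    have : ∀ μ, fieldTensor (0 : Spacetime → Fin 4 → ℝ) μ ν = fun _ => 0 := fun μ => by
      funext y
      simp [fieldTensor, h0]
    simp [this, h0]
  add_mem' := by
    rintro ζ ξ ⟨h1, h2, h3⟩ ⟨k1, k2, k3⟩
    refine ⟨h1.add k1, h2.add k2, fun ν x => ?_⟩
    have h3 := h3 ν x
    have k3 := k3 ν x
    simp only [fieldTensor_add h1 k1,
      pd_add (contDiff_fieldTensor h1 _ ν) (contDiff_fieldTensor k1 _ ν),
      mul_add, Finset.sum_add_distrib]
    linarith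
  smul_mem' := by
    rintro c ζ ⟨h1, h2, h3⟩
    refine ⟨contDiff_const.smul h1, h2.smul c, fun ν x => ?_⟩
    have h3 := h3 ν x
    simp only [fieldTensor_smul c h1, pd_smul c (contDiff_fieldTensor h1 _ ν),
      mul_left_comm _ c, ← Finset.mul_sum]
    rw [← mul_neg, h3, mul_zero]

theorem continuous_event (t : ℝ) : Continuous (event t) := by
  refine continuous_pi fun μ => ?_
  refine Fin.cases ?_ (fun i => ?_) μ
  · simpa [event] using continuous_const
  · simp only [event, Fin.cons_succ]
    fun_prop

/-- On a time slice a space-compact function vanishes outside a compact set. -/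
theorem IsSpaceCompact.slice {ζ : Spacetime → Fin 4 → ℝ} (h : IsSpaceCompact ζ) (t : ℝ) :
    ∃ C : Set Space, IsCompact C ∧ ∀ x, x ∉ C → ζ (event t x) = 0 := by
  obtain ⟨K, hK, hs⟩ := h
  obtain ⟨R, hR⟩ := hK.isBounded.exists_norm_le
  refine ⟨(EuclideanSpace.equiv (Fin 3) ℝ).symm '' Metric.closedBall 0 (|t| + 2 * R),
    (isCompact_closedBall _ _).image (EuclideanSpace.equiv (Fin 3) ℝ).symm.continuous,
    fun x hx => ?_⟩
  by_contra hne
  apply hx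
  obtain ⟨k, hk, v, ⟨-, hv⟩, hkv⟩ := hs (subset_tsupport _ (Function.mem_support.2 hne))
  have hkμ : ∀ μ, |k μ| ≤ R := fun μ => (norm_le_pi_norm k μ).trans (hR k hk)
  have hR0 : 0 ≤ R := (abs_nonneg _).trans (hkμ 0)
  have h0 : k 0 + v 0 = t := by simpa [event] using congrFun hkv 0
  have hi : ∀ i : Fin 3, k i.succ + v i.succ = x i := fun i => by
    simpa [event] using congrFun hkv i.succ
  have hv0 : |v 0| ≤ |t| + R := by
    have : v 0 = t - k 0 := by linarith
    rw [this]
    exact (abs_sub _ _).trans (by linarith [hkμ 0])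
  rw [Fin.sum_univ_succ] at hv
  simp only [metric, Fin.succ_ne_zero, if_true, if_false, one_mul] at hv
  refine ⟨fun i => x i, ?_, by ext i; simp⟩
  rw [mem_closedBall_zero_iff, pi_norm_le_iff_of_nonneg (by positivity)]
  intro i
  have hle : v i.succ ^ 2 ≤ v 0 ^ 2 := by
    have := Finset.single_le_sum (f := fun i : Fin 3 => v i.succ ^ 2)
      (fun j _ => sq_nonneg _) (Finset.mem_univ i)
    linarith
  have := sq_le_sq.1 hle
  rw [Real.norm_eq_abs, ← hi i]
  exact (abs_add_le _ _).trans (by linarith [hkμ i.succ])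

/-- The density of the flux is integrable. -/
theorem integrable_current (t : ℝ) {ζ₁ ζ₂ : Spacetime → Fin 4 → ℝ} (h₁ : ContDiff ℝ ∞ ζ₁)
    (h₂ : ContDiff ℝ ∞ ζ₂) (k₁ : IsSpaceCompact ζ₁) (k₂ : IsSpaceCompact ζ₂) :
    Integrable (fun x : Space => current ζ₁ ζ₂ 0 (event t x)) := by
  obtain ⟨C, hC, hz⟩ := k₁.slice t
  obtain ⟨D, hD, hw⟩ := k₂.slice t
  refine Continuous.integrable_of_hasCompactSupport ?_ ?_
  · refine Continuous.comp (g := current ζ₁ ζ₂ 0) ?_ (continuous_event t)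
    have a := fun ν => (contDiff_component h₁ ν).continuous
    have b := fun ν => (contDiff_component h₂ ν).continuous
    have c := fun ν => (contDiff_fieldTensor h₁ 0 ν).continuous
    have d := fun ν => (contDiff_fieldTensor h₂ 0 ν).continuous
    unfold current
    fun_prop
  · refine HasCompactSupport.intro (hC.union hD) fun x hx => ?_
    have e1 : ζ₁ (event t x) = 0 := hz x fun h => hx (Or.inl h)
    have e2 : ζ₂ (event t x) = 0 := hw x fun h => hx (Or.inr h)
    simp [current, e1, e2]

theorem flux_swap (t : ℝ) (ζ₁ ζ₂ : Spacetime → Fin 4 → ℝ) : flux t ζ₁ ζ₂ = -flux t ζ₂ ζ₁ := by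
  rw [flux, flux, ← integral_neg]
  congr 1
  funext x
  rw [current, current, ← Finset.sum_neg_distrib]
  refine Finset.sum_congr rfl fun ν _ => ?_
  ring

theorem flux_add_left (t : ℝ) (ζ₁ ζ₂ ξ : solutionSpace) :
    flux t (ζ₁ + ζ₂ : solutionSpace) ξ = flux t ζ₁ ξ + flux t ζ₂ ξ := by
  rw [flux, flux, flux, ← integral_add
    (integrable_current t ζ₁.2.1 ξ.2.1 ζ₁.2.2.1 ξ.2.2.1)
    (integrable_current t ζ₂.2.1 ξ.2.1 ζ₂.2.2.1 ξ.2.2.1)]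
  congr 1
  funext x
  simp only [current, Submodule.coe_add, fieldTensor_add ζ₁.2.1 ζ₂.2.1, Pi.add_apply]
  rw [← Finset.sum_add_distrib]
  refine Finset.sum_congr rfl fun ν _ => ?_
  ring

theorem flux_smul_left (t c : ℝ) (ζ ξ : solutionSpace) :
    flux t (c • ζ : solutionSpace) ξ = c * flux t ζ ξ := by
  rw [flux, flux, ← integral_const_mul]
  congr 1
  funext x
  simp only [current, Submodule.coe_smul, fieldTensor_smul c ζ.2.1, Pi.smul_apply, smul_eq_mul]
  rw [Finset.mul_sum]
  refine Finset.sum_congr rfl fun ν _ => ?_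
  ring

/-! ### The presymplectic form and its reduction -/

/-- The presymplectic form `ω` on the space of solutions, computed on the surface `x^0 = 0`. -/
def omega : LinearMap.BilinForm ℝ solutionSpace :=
  LinearMap.mk₂ ℝ (fun ζ₁ ζ₂ => flux 0 ζ₁ ζ₂)
    (flux_add_left 0)
    (flux_smul_left 0)
    (fun ζ ξ₁ ξ₂ => by
      rw [flux_swap, flux_add_left, flux_swap 0 ξ₁, flux_swap 0 ξ₂]; ring)
    (fun c ζ ξ => by
      rw [flux_swap, flux_smul_left, flux_swap 0 ξ, smul_eq_mul]; ring)

/-- The reduced space `Y_Max`: the quotient of the space of solutions by the kernel of `ω`. -/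
abbrev ReducedSpace := solutionSpace ⧸ LinearMap.ker omega

/-! ### The Coulomb gauge -/

/-- The divergence of the spatial part of `ζ`. -/
def spatialDiv (ζ : Spacetime → Fin 4 → ℝ) (x : Spacetime) : ℝ :=
  ∑ i : Fin 3, pd i.succ (fun y => ζ y i.succ) x

/-- `ζ` is in the Coulomb gauge: `ζ_0 = 0` and the spatial part is divergence free. -/
def IsCoulombGauge (ζ : Spacetime → Fin 4 → ℝ) : Prop :=
  (∀ x, ζ x 0 = 0) ∧ ∀ x, spatialDiv ζ x = 0

/-- `(-Δ)⁻¹ ρ`, the Newtonian potential of `ρ`. -/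
def invNegLaplacian (ρ : Space → ℝ) (x : Space) : ℝ :=
  ∫ y : Space, 1 / (4 * Real.pi * ‖x - y‖) * ρ y

/-- `χ(t, x) = -(-Δ)⁻¹ div ζ (t, x)`. -/
def coulombPotential (ζ : Spacetime → Fin 4 → ℝ) (x : Spacetime) : ℝ :=
  -invNegLaplacian (fun y => spatialDiv ζ (event (x 0) y)) (spatial x)

/-- The Coulomb-gauge representative `ζ^Coul = ζ - ∂χ`, with `χ = -(-Δ)⁻¹ div ζ`. -/
def coulombRep (ζ : Spacetime → Fin 4 → ℝ) : Spacetime → Fin 4 → ℝ :=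
  ζ - gradient (coulombPotential ζ)

end Maxwell

end

/-! Everything rests on one inversion formula. Call a function slice-compact if its spatial support
is bounded, locally uniformly in time; all components of space-compact potentials, and their
derivatives, are of this kind. For smooth slice-compact `g`, the convolution of `1 / (4π|x|)` with
`Δg` on each time slice is `-g` (`sliceConv_newtonKernel_spatialLaplacian`). In particular a
slice-compact function that is harmonic on every slice vanishes.

Coulomb gauge: Gauss's law reads `∂₀ div ζ = Δζ₀`, so the inversion formula gives `∂₀χ = ζ₀`, while
`Δχ = div ζ`. Hence `ζ - ∂χ` has no time component and no divergence. Time independence of the form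
is conservation of the current.

If `ζ = ∂χ`, its field vanishes and the flux against `ξ` is the integral of `∂χ` against the
electric field of `ξ`. Integration by parts and Gauss's law make it zero; compactness comes from `ξ`
alone, so `χ` may be arbitrary.

Conversely, let `ζ` be in the kernel. Test it at an event `a` with the solution `ξ_k = ∂_l u`, `ξ_l
= -∂_k u`, where `u` is a spherical wave centred at `a` and at rest at the time of `a`. The flux
through that slice is the integral of a component of `curl E` against `u`, where `E_i = F_{0i}`;
concentrating `u` yields `curl E = 0` at `a` (`pd_electric_comm`). With Gauss's law `ΔE = 0`, so `E
= 0`. Ampère's law and the Bianchi identity then give `ΔF_{jk} = 0`, so the magnetic field vanishes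
too. Finally `F_{jk} = 0` means `∂_i div ζ = Δζ_i`, so the inversion formula gives `∂_iχ = ζ_i`.

The wave `u` is `(F(t + r) - F(t - r)) / r` with `F` odd. Its smoothness at `r = 0` is obtained by
writing it as a mean over `[-1, 1]`, a family of means closed under differentiation
(`hasFDerivAt_radialMean`). -/

namespace Maxwell

/-! ### Splitting of Minkowski space -/

/-- The projection on the spatial part as a continuous linear map. -/
noncomputable def spatialCLM : Spacetime →L[ℝ] Space :=
  ((EuclideanSpace.equiv (Fin 3) ℝ).symm : (Fin 3 → ℝ) →L[ℝ] Space).comp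
    (ContinuousLinearMap.pi fun i : Fin 3 => ContinuousLinearMap.proj i.succ)

/-- The map `(t, x) ↦ event t x` as a continuous linear map. -/
noncomputable def eventCLM : ℝ × Space →L[ℝ] Spacetime :=
  ContinuousLinearMap.pi (Fin.cons (ContinuousLinearMap.fst ℝ ℝ Space)
    (fun i => (EuclideanSpace.proj i).comp (ContinuousLinearMap.snd ℝ ℝ Space)))

theorem spatialCLM_apply (x : Spacetime) : spatialCLM x = spatial x := rfl

theorem eventCLM_apply (p : ℝ × Space) : eventCLM p = event p.1 p.2 := by
  funext μ
  refine Fin.cases ?_ (fun i => ?_) μ <;> simp [eventCLM, event]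

@[simp] theorem event_apply_zero (t : ℝ) (x : Space) : event t x 0 = t := rfl

@[simp] theorem event_apply_succ (t : ℝ) (x : Space) (i : Fin 3) : event t x i.succ = x i := rfl

@[simp] theorem spatial_apply (x : Spacetime) (i : Fin 3) : spatial x i = x i.succ := rfl

@[simp] theorem spatial_event (t : ℝ) (x : Space) : spatial (event t x) = x := rfl

@[simp] theorem event_spatial (x : Spacetime) : event (x 0) (spatial x) = x := by
  funext μ
  refine Fin.cases rfl (fun i => rfl) μ

theorem continuous_spatial : Continuous spatial := spatialCLM.continuous

theorem norm_spatial_sq (x : Spacetime) : ‖spatial x‖ ^ 2 = ∑ i : Fin 3, x i.succ ^ 2 := by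
  rw [EuclideanSpace.norm_sq_eq]
  simp

/-! ### Rules for partial derivatives -/

theorem pd_of_hasFDerivAt {f : Spacetime → ℝ} {f' : Spacetime →L[ℝ] ℝ} {x : Spacetime}
    (h : HasFDerivAt f f' x) (μ : Fin 4) : pd μ f x = f' (Pi.single μ 1) := by
  rw [pd, h.fderiv]

theorem pd_const (c : ℝ) (μ : Fin 4) : pd μ (fun _ => c) = fun _ => 0 := by
  funext y
  simp [pd]

theorem pd_sub {f g : Spacetime → ℝ} (hf : ContDiff ℝ ∞ f) (hg : ContDiff ℝ ∞ g) (μ : Fin 4) :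
    pd μ (fun y => f y - g y) = fun x => pd μ f x - pd μ g x := by
  funext x
  have := fderiv_fun_sub (hf.differentiable (by simp) x) (hg.differentiable (by simp) x)
  simp [pd, this]

theorem pd_neg (f : Spacetime → ℝ) (μ : Fin 4) :
    pd μ (fun y => -f y) = fun x => -pd μ f x := by
  funext x
  simp [pd]

theorem pd_mul {f g : Spacetime → ℝ} (hf : ContDiff ℝ ∞ f) (hg : ContDiff ℝ ∞ g) (μ : Fin 4) :
    pd μ (fun y => f y * g y) = fun x => pd μ f x * g x + f x * pd μ g x := by
  funext x
  have := fderiv_fun_mul (hf.differentiable (by simp) x) (hg.differentiable (by simp) x)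
  simp only [pd, this, add_apply, smul_apply, smul_eq_mul]
  ring

theorem pd_sum {ι : Type*} (s : Finset ι) {f : ι → Spacetime → ℝ}
    (hf : ∀ i, ContDiff ℝ ∞ (f i)) (μ : Fin 4) :
    pd μ (fun y => ∑ i ∈ s, f i y) = fun x => ∑ i ∈ s, pd μ (f i) x := by
  funext x
  have := fderiv_fun_sum (u := s) (fun i _ => (hf i).differentiable (by simp) x)
  simp [pd, this]

theorem pd_comm {f : Spacetime → ℝ} (hf : ContDiff ℝ ∞ f) (μ ν : Fin 4) :
    pd μ (pd ν f) = pd ν (pd μ f) := by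
  have h : ∀ μ ν x, pd μ (pd ν f) x
      = fderiv ℝ (fderiv ℝ f) x (Pi.single μ 1) (Pi.single ν 1) := fun μ ν x => by
    have hd : DifferentiableAt ℝ (fderiv ℝ f) x :=
      (hf.fderiv_right (m := ∞) (by simp)).differentiable (by simp) x
    have := (hd.hasFDerivAt.clm_apply (hasFDerivAt_const (Pi.single ν (1 : ℝ)) x))
    rw [pd_of_hasFDerivAt (f := pd ν f) this]
    simp
  funext x
  rw [h, h]
  have hs : IsSymmSndFDerivAt ℝ f x := hf.contDiffAt.isSymmSndFDerivAt (by
    rw [minSmoothness_of_isRCLikeNormedField]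
    exact WithTop.coe_le_coe.2 (le_top : (2 : ℕ∞) ≤ ⊤))
  exact hs.eq _ _

theorem contDiff_coord (μ : Fin 4) : ContDiff ℝ ∞ fun x : Spacetime => x μ := contDiff_apply _ _ _

theorem pd_coord (μ ν : Fin 4) (x : Spacetime) :
    pd μ (fun x : Spacetime => x ν) x = if ν = μ then 1 else 0 := by
  rw [pd_of_hasFDerivAt (hasFDerivAt_apply ν x)]
  simp [Pi.single_apply]

/-! ### Functions with spatially compact support, locally uniformly in time -/

/-- On every bounded interval of times, `g` vanishes outside a bounded region of space. -/
def SliceCompact (g : Spacetime → ℝ) : Prop :=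
  ∀ T : ℝ, ∃ R : ℝ, ∀ x : Spacetime, |x 0| ≤ T → R < ‖spatial x‖ → g x = 0

/-- The spatial part of a causal vector is no longer than its time component, so up to time `T` the
shadow of `K` exceeds the spatial extent of `K` by at most `T + R`. -/
theorem IsSpaceCompact.sliceCompact {ζ : Spacetime → Fin 4 → ℝ} (h : IsSpaceCompact ζ)
    (μ : Fin 4) : SliceCompact (fun x => ζ x μ) := by
  obtain ⟨K, hK, hs⟩ := h
  obtain ⟨r, hr⟩ := (hK.image continuous_spatial).isBounded.exists_norm_le
  obtain ⟨R, hR⟩ := hK.isBounded.exists_norm_le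
  refine fun T => ⟨r + (T + R), fun x hT hx => ?_⟩
  by_contra hne
  have hne' : ζ x ≠ 0 := fun h => hne (congrFun h μ)
  obtain ⟨k, hk, v, ⟨-, hv⟩, rfl⟩ := hs (subset_tsupport _ (Function.mem_support.2 hne'))
  have h0 : |k 0| ≤ R := (norm_le_pi_norm k 0).trans (hR k hk)
  have hv0 : |v 0| ≤ T + R := by
    have : v 0 = (k + v) 0 - k 0 := by simp
    rw [this]
    exact (abs_sub _ _).trans (by linarith)
  rw [Fin.sum_univ_succ] at hv
  simp only [metric, Fin.succ_ne_zero, if_true, if_false, one_mul, ← norm_spatial_sq] at hv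
  have hsv : ‖spatial v‖ ≤ |v 0| := by
    rw [← abs_of_nonneg (norm_nonneg (spatial v))]
    exact sq_le_sq.1 (by linarith)
  have hadd : spatial (k + v) = spatial k + spatial v := spatialCLM.map_add k v
  have := norm_add_le (spatial k) (spatial v)
  have := hr _ (Set.mem_image_of_mem _ hk)
  rw [hadd] at hx
  linarith

theorem SliceCompact.fderiv {g : Spacetime → ℝ} (hg : SliceCompact g) (T : ℝ) :
    ∃ R : ℝ, ∀ x : Spacetime, |x 0| ≤ T → R < ‖spatial x‖ → fderiv ℝ g x = 0 := by
  -- The margin in time makes `g` vanish on an open neighbourhood of `x`, even when `|x 0| = T`.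
  obtain ⟨R, hR⟩ := hg (T + 1)
  refine ⟨R, fun x hT hx => ?_⟩
  have hU : IsOpen ({x : Spacetime | |x 0| < T + 1} ∩ {x | R < ‖spatial x‖}) :=
    (isOpen_lt (continuous_apply 0).abs continuous_const).inter
      (isOpen_lt continuous_const continuous_spatial.norm)
  have : g =ᶠ[nhds x] fun _ => 0 := Filter.eventually_of_mem
    (hU.mem_nhds ⟨hT.trans_lt (by linarith), hx⟩) fun y hy => hR y (le_of_lt hy.1) hy.2
  rw [this.fderiv_eq]
  simp

theorem SliceCompact.pd {g : Spacetime → ℝ} (hg : SliceCompact g) (μ : Fin 4) :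
    SliceCompact (pd μ g) := fun T => by
  obtain ⟨R, hR⟩ := hg.fderiv T
  exact ⟨R, fun x h1 h2 => by simp [Maxwell.pd, hR x h1 h2]⟩

theorem SliceCompact.mul_left {g : Spacetime → ℝ} (hg : SliceCompact g) (f : Spacetime → ℝ) :
    SliceCompact fun x => f x * g x := fun T => by
  obtain ⟨R, hR⟩ := hg T
  exact ⟨R, fun x h1 h2 => by simp [hR x h1 h2]⟩

theorem SliceCompact.add {f g : Spacetime → ℝ} (hf : SliceCompact f) (hg : SliceCompact g) :
    SliceCompact fun x => f x + g x := fun T => by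
  obtain ⟨R, hR⟩ := hf T
  obtain ⟨S, hS⟩ := hg T
  refine ⟨max R S, fun x h1 h2 => ?_⟩
  simp [hR x h1 ((le_max_left _ _).trans_lt h2), hS x h1 ((le_max_right _ _).trans_lt h2)]

theorem SliceCompact.neg {g : Spacetime → ℝ} (hg : SliceCompact g) :
    SliceCompact fun x => -g x := fun T => by
  obtain ⟨R, hR⟩ := hg T
  exact ⟨R, fun x h1 h2 => by simp [hR x h1 h2]⟩

theorem SliceCompact.sub {f g : Spacetime → ℝ} (hf : SliceCompact f) (hg : SliceCompact g) :
    SliceCompact fun x => f x - g x := by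
  simpa only [sub_eq_add_neg] using hf.add hg.neg

theorem SliceCompact.sum {ι : Type*} (s : Finset ι) {f : ι → Spacetime → ℝ}
    (hf : ∀ i, SliceCompact (f i)) : SliceCompact fun x => ∑ i ∈ s, f i x := by
  classical
  induction s using Finset.induction_on with
  | empty => exact fun T => ⟨0, fun x _ _ => by simp⟩
  | insert a s ha ih => simpa only [Finset.sum_insert ha] using (hf a).add ih

theorem SliceCompact.exists_isCompact {g : Spacetime → ℝ} (hg : SliceCompact g) (T : ℝ) :
    ∃ C : Set Space, IsCompact C ∧ ∀ t, ∀ x, |t| ≤ T → x ∉ C → g (event t x) = 0 := by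
  obtain ⟨R, hR⟩ := hg T
  refine ⟨Metric.closedBall 0 R, isCompact_closedBall _ _, fun t x ht hx => hR _ ht ?_⟩
  simpa using hx

theorem SliceCompact.hasCompactSupport {g : Spacetime → ℝ} (hg : SliceCompact g) (t : ℝ) :
    HasCompactSupport fun x : Space => g (event t x) := by
  obtain ⟨C, hC, h⟩ := hg.exists_isCompact |t|
  exact HasCompactSupport.intro hC fun x hx => h t x le_rfl hx

theorem SliceCompact.integrable {g : Spacetime → ℝ} (hg : SliceCompact g) (hc : Continuous g)
    (t : ℝ) : Integrable fun x : Space => g (event t x) :=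
  (hc.comp (continuous_event t)).integrable_of_hasCompactSupport (hg.hasCompactSupport t)

/-! ### Convolution on time slices -/

/-- The convolution of the kernel `k` with `g` on every time slice. -/
noncomputable def sliceConv (k : Space → ℝ) (g : Spacetime → ℝ) (x : Spacetime) : ℝ :=
  ∫ y : Space, k (spatial x - y) * g (event (x 0) y)

theorem sliceConv_eq_convolution (k : Space → ℝ) (g : Spacetime → ℝ) :
    sliceConv k g = (fun q : ℝ × Space => convolution k (fun y => g (event q.1 y))
      (ContinuousLinearMap.mul ℝ ℝ) volume q.2) ∘
      ((ContinuousLinearMap.proj 0).prod spatialCLM : Spacetime →L[ℝ] ℝ × Space) := by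
  funext x
  simp only [Function.comp, convolution_eq_swap]
  rfl

theorem contDiff_uncurry_event {g : Spacetime → ℝ} (hg : ContDiff ℝ ∞ g) :
    ContDiff ℝ ∞ (Function.HasUncurry.uncurry fun (t : ℝ) (y : Space) => g (event t y)) := by
  have : (Function.HasUncurry.uncurry fun (t : ℝ) (y : Space) => g (event t y))
      = g ∘ eventCLM := by
    funext p
    simp [eventCLM_apply, Function.HasUncurry.uncurry]
  rw [this]
  exact hg.comp eventCLM.contDiff

/-- All derivatives fall on `g`, so local integrability of the kernel suffices. Time enters as a
parameter, and slice-compactness supplies one compact set containing the supports for all nearby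
times. -/
theorem contDiff_sliceConv {k : Space → ℝ} (hk : LocallyIntegrable k) {g : Spacetime → ℝ}
    (hg : ContDiff ℝ ∞ g) (hc : SliceCompact g) : ContDiff ℝ ∞ (sliceConv k g) := by
  rw [sliceConv_eq_convolution]
  refine ContDiff.comp ?_ (ContinuousLinearMap.contDiff _)
  rw [contDiff_iff_contDiffAt]
  intro q
  obtain ⟨C, hC, h⟩ := hc.exists_isCompact (|q.1| + 1)
  have := contDiffOn_convolution_right_with_param (n := ⊤) (μ := volume)
    (ContinuousLinearMap.mul ℝ ℝ) (g := fun (t : ℝ) (y : Space) => g (event t y))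
    (s := {t | |t| < |q.1| + 1}) (isOpen_lt continuous_abs continuous_const) hC
    (fun p x hp hx => h p x (le_of_lt hp) hx) hk (contDiff_uncurry_event hg).contDiffOn
  refine this.contDiffAt (IsOpen.mem_nhds ?_ ⟨by simp, trivial⟩)
  exact (isOpen_lt continuous_abs continuous_const).prod isOpen_univ

theorem pd_sliceConv {k : Space → ℝ} (hk : LocallyIntegrable k) {g : Spacetime → ℝ}
    (hg : ContDiff ℝ ∞ g) (hc : SliceCompact g) (μ : Fin 4) :
    pd μ (sliceConv k g) = sliceConv k (pd μ g) := by
  funext x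
  obtain ⟨C, hC, h⟩ := hc.exists_isCompact (|x 0| + 1)
  have hfd : ∀ p : ℝ × Space,
      fderiv ℝ (Function.HasUncurry.uncurry fun (t : ℝ) (y : Space) => g (event t y)) p
        = (fderiv ℝ g (event p.1 p.2)).comp eventCLM := fun p => by
    have : (Function.HasUncurry.uncurry fun (t : ℝ) (y : Space) => g (event t y))
        = g ∘ eventCLM := by
      funext p
      simp [eventCLM_apply, Function.HasUncurry.uncurry]
    rw [this, fderiv_comp p (hg.differentiable (by simp) _) eventCLM.differentiableAt,
      eventCLM.fderiv, eventCLM_apply]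
  have key := hasFDerivAt_convolution_right_with_param (μ := volume)
    (ContinuousLinearMap.mul ℝ ℝ) (g := fun (t : ℝ) (y : Space) => g (event t y))
    (s := {t | |t| < |x 0| + 1}) (isOpen_lt continuous_abs continuous_const) hC
    (fun p x hp hx => h p x (le_of_lt hp) hx) hk
    ((contDiff_uncurry_event hg).of_le (by simp)).contDiffOn (x 0, spatial x)
    (show |x 0| < |x 0| + 1 by simp)
  have key2 := key.comp x
    ((ContinuousLinearMap.proj 0).prod spatialCLM : Spacetime →L[ℝ] ℝ × Space).hasFDerivAt
  rw [sliceConv_eq_convolution k g, pd_of_hasFDerivAt key2]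
  simp only [hfd]
  rw [ContinuousLinearMap.comp_apply, convolution_precompR_apply, convolution_eq_swap]
  · simp only [sliceConv, pd, ContinuousLinearMap.comp_apply, ContinuousLinearMap.mul_apply']
    have : eventCLM ((ContinuousLinearMap.prod (ContinuousLinearMap.proj 0) spatialCLM)
        (Pi.single μ 1 : Spacetime)) = Pi.single μ 1 := by
      rw [eventCLM_apply]
      exact event_spatial (Pi.single μ 1 : Spacetime)
    simp only [this]
  · exact hk
  · obtain ⟨R, hR⟩ := hc.fderiv |x 0|
    refine HasCompactSupport.intro (isCompact_closedBall 0 R) fun y hy => ?_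
    have : fderiv ℝ g (event (x 0) y) = 0 := hR _ le_rfl (by simpa using hy)
    simp [this]
  · have := (hg.continuous_fderiv (by simp)).comp (continuous_event (x 0))
    fun_prop

/-- With the constant kernel `1`, `sliceConv` is the integral over the slice. It does not depend on
the spatial point, so its spatial derivatives vanish, and differentiation passes inside. -/
theorem integral_pd_succ {g : Spacetime → ℝ} (hg : ContDiff ℝ ∞ g) (hc : SliceCompact g)
    (i : Fin 3) (t : ℝ) : ∫ x : Space, pd i.succ g (event t x) = 0 := by
  have hk : LocallyIntegrable fun _ : Space => (1 : ℝ) := locallyIntegrable_const 1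
  have h := congrFun (pd_sliceConv hk hg hc i.succ) (event t 0)
  have h1 : ∀ f, sliceConv (fun _ => 1) f (event t 0) = ∫ x : Space, f (event t x) := fun f => by
    simp [sliceConv]
  rw [h1] at h
  rw [← h]
  have hd := (contDiff_sliceConv hk hg hc).differentiable (by simp) (event t 0)
  rw [pd, ← hd.lineDeriv_eq_fderiv, lineDeriv]
  have : ∀ s : ℝ, sliceConv (fun _ => 1) g (event t 0 + s • Pi.single i.succ 1)
      = sliceConv (fun _ => 1) g (event t 0) := fun s => by simp [sliceConv]
  simp [this]

theorem hasDerivAt_integral_slice {g : Spacetime → ℝ} (hg : ContDiff ℝ ∞ g)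
    (hc : SliceCompact g) (t : ℝ) :
    HasDerivAt (fun s => ∫ x : Space, g (event s x)) (∫ x : Space, pd 0 g (event t x)) t := by
  have hk : LocallyIntegrable fun _ : Space => (1 : ℝ) := locallyIntegrable_const 1
  have h := congrFun (pd_sliceConv hk hg hc 0) (event t 0)
  have h1 : ∀ f s, sliceConv (fun _ => 1) f (event s 0) = ∫ x : Space, f (event s x) :=
    fun f s => by simp [sliceConv]
  rw [h1] at h
  rw [← h]
  simp only [← h1]
  have hd := (contDiff_sliceConv hk hg hc).differentiable (by simp) (event t 0)
  have he : ∀ s : ℝ, event s (0 : Space) = s • Pi.single 0 1 := fun s => by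
    funext μ
    refine Fin.cases ?_ (fun i => ?_) μ <;> simp
  have hl : HasDerivAt (fun s : ℝ => event s (0 : Space)) (Pi.single 0 1) t := by
    simp only [he]
    simpa using (hasDerivAt_id t).smul_const (Pi.single 0 1 : Spacetime)
  exact hd.hasFDerivAt.comp_hasDerivAt t hl

/-- Only `g` is required to be slice-compact; this allows gauge functions and regularised Newtonian
kernels of unbounded support as `f`. -/
theorem integral_mul_pd_succ {f g : Spacetime → ℝ} (hf : ContDiff ℝ ∞ f) (hg : ContDiff ℝ ∞ g)
    (hc : SliceCompact g) (i : Fin 3) (t : ℝ) :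
    ∫ x : Space, f (event t x) * pd i.succ g (event t x)
      = -∫ x : Space, pd i.succ f (event t x) * g (event t x) := by
  have h := integral_pd_succ (hf.mul hg) (hc.mul_left f) i t
  rw [pd_mul hf hg, integral_add] at h
  · linarith
  · exact (hc.mul_left _).integrable ((contDiff_pd hf _).mul hg).continuous t
  · exact ((hc.pd _).mul_left _).integrable (hf.mul (contDiff_pd hg _)).continuous t

/-! ### The Newtonian potential -/

/-- The spatial Laplacian `Δ f = ∑ i, ∂_i ∂_i f`. -/
noncomputable def spatialLaplacian (f : Spacetime → ℝ) (x : Spacetime) : ℝ :=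
  ∑ i : Fin 3, pd i.succ (pd i.succ f) x

theorem contDiff_spatialLaplacian {f : Spacetime → ℝ} (hf : ContDiff ℝ ∞ f) :
    ContDiff ℝ ∞ (spatialLaplacian f) :=
  ContDiff.sum fun _ _ => contDiff_pd (contDiff_pd hf _) _

theorem SliceCompact.spatialLaplacian {f : Spacetime → ℝ} (hf : SliceCompact f) :
    SliceCompact (spatialLaplacian f) :=
  SliceCompact.sum _ fun _ => (hf.pd _).pd _

/-- The kernel `1 / (4 π |x|)` of `(-Δ)⁻¹`. -/
noncomputable def newtonKernel (x : Space) : ℝ := 1 / (4 * Real.pi * ‖x‖)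

/-- The form to be regularised by replacing `‖x‖ ^ 2` with `‖x‖ ^ 2 + δ`. At the origin both sides
are `0` by the conventions for division and negative powers. -/
theorem newtonKernel_eq_rpow (x : Space) :
    newtonKernel x = 1 / (4 * Real.pi) * (‖x‖ ^ 2) ^ (-1 / 2 : ℝ) := by
  rw [newtonKernel, ← Real.rpow_natCast _ 2, ← Real.rpow_mul (norm_nonneg x)]
  norm_num [Real.rpow_neg_one]
  ring

theorem locallyIntegrable_newtonKernel : LocallyIntegrable newtonKernel := by
  refine locallyIntegrable_of_norm_le_rpow (C := 1 / (4 * Real.pi)) (α := 1) (by simp)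
    (by simp) (Filter.Eventually.of_forall fun x => ?_) ?_
  · rw [newtonKernel, Real.rpow_neg_one, Real.norm_of_nonneg (by positivity)]
    simp only [one_div, mul_inv]
    exact le_rfl
  · unfold newtonKernel
    exact (measurable_const.div (measurable_const.mul measurable_norm)).aestronglyMeasurable

theorem integrable_newtonKernel_mul {g : Spacetime → ℝ} (hg : ContDiff ℝ ∞ g)
    (hc : SliceCompact g) (t : ℝ) (x : Space) :
    Integrable fun y : Space => newtonKernel (x - y) * g (event t y) := by
  have h := (hc.hasCompactSupport t).convolutionExists_right (ContinuousLinearMap.mul ℝ ℝ)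
    locallyIntegrable_newtonKernel (hg.continuous.comp (continuous_event t)) x
  exact (convolutionExistsAt_iff_integrable_swap.1 h)

theorem pd_rpow {f : Spacetime → ℝ} (hf : ContDiff ℝ ∞ f) (hpos : ∀ x, 0 < f x) (p : ℝ)
    (μ : Fin 4) : pd μ (fun y => f y ^ p) = fun x => p * (f x ^ (p - 1) * pd μ f x) := by
  funext x
  have := ((hf.differentiable (by simp) x).hasFDerivAt.rpow_const (p := p)
    (Or.inl (hpos x).ne'))
  rw [pd_of_hasFDerivAt this]
  simp [pd, mul_assoc]

/-- The squared distance `|x - w|² + δ` to the point `w` of space, regularised by `δ`. -/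
noncomputable def regDist (w : Space) (δ : ℝ) (x : Spacetime) : ℝ :=
  ∑ i : Fin 3, (x i.succ - w i) * (x i.succ - w i) + δ

theorem contDiff_sub_const (w : ℝ) (μ : Fin 4) : ContDiff ℝ ∞ fun x : Spacetime => x μ - w :=
  (contDiff_coord μ).sub contDiff_const

theorem pd_sub_const (w : ℝ) (μ ν : Fin 4) (x : Spacetime) :
    pd μ (fun x : Spacetime => x ν - w) x = if ν = μ then 1 else 0 := by
  rw [pd_sub (contDiff_coord ν) contDiff_const, pd_const]
  simp only [pd_coord, sub_zero]

theorem contDiff_regDist (w : Space) (δ : ℝ) : ContDiff ℝ ∞ (regDist w δ) :=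
  (ContDiff.sum fun _ _ => (contDiff_sub_const _ _).mul (contDiff_sub_const _ _)).add contDiff_const

theorem regDist_pos (w : Space) {δ : ℝ} (hδ : 0 < δ) (x : Spacetime) : 0 < regDist w δ x :=
  add_pos_of_nonneg_of_pos (Finset.sum_nonneg fun _ _ => mul_self_nonneg _) hδ

theorem regDist_event (w : Space) (δ t : ℝ) (y : Space) :
    regDist w δ (event t y) = ‖w - y‖ ^ 2 + δ := by
  rw [regDist, norm_sub_rev, EuclideanSpace.norm_sq_eq]
  simp [sq]

theorem pd_regDist (w : Space) (δ : ℝ) (i : Fin 3) (x : Spacetime) :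
    pd i.succ (regDist w δ) x = 2 * (x i.succ - w i) := by
  have h : ∀ j : Fin 3, ContDiff ℝ ∞ fun x : Spacetime => (x j.succ - w j) * (x j.succ - w j) :=
    fun j => (contDiff_sub_const _ _).mul (contDiff_sub_const _ _)
  have e : regDist w δ = fun x =>
    (fun x => ∑ j : Fin 3, (x j.succ - w j) * (x j.succ - w j)) x + (fun _ => δ) x := rfl
  rw [e, pd_add (ContDiff.sum fun j _ => h j) contDiff_const, pd_const, pd_sum _ h]
  simp only [pd_mul (contDiff_sub_const _ _) (contDiff_sub_const _ _), pd_sub_const, Fin.succ_inj]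
  simp [← two_mul]

/-- The regularised Newtonian potential is smooth with an explicit Laplacian. -/
theorem spatialLaplacian_regDist_rpow (w : Space) {δ : ℝ} (hδ : 0 < δ) (x : Spacetime) :
    spatialLaplacian (fun y => regDist w δ y ^ (-1 / 2 : ℝ)) x
      = -(3 * δ * regDist w δ x ^ (-5 / 2 : ℝ)) := by
  have hs := contDiff_regDist w δ
  have hp := regDist_pos w hδ
  have hr : ∀ p : ℝ, ContDiff ℝ ∞ fun y => regDist w δ y ^ p := fun p =>
    hs.rpow_const_of_ne fun y => (hp y).ne'
  have h1 : ∀ i : Fin 3, pd i.succ (pd i.succ fun y => regDist w δ y ^ (-1 / 2 : ℝ)) x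
      = 3 * regDist w δ x ^ (-5 / 2 : ℝ) * ((x i.succ - w i) * (x i.succ - w i))
        - regDist w δ x ^ (-3 / 2 : ℝ) := fun i => by
    have e : (pd i.succ fun y => regDist w δ y ^ (-1 / 2 : ℝ))
        = fun y => (-1) * (regDist w δ y ^ (-3 / 2 : ℝ) * (y i.succ - w i)) := by
      rw [pd_rpow hs hp]
      funext y
      rw [pd_regDist]
      norm_num
      ring
    rw [e, pd_smul _ ((hr _).mul (contDiff_sub_const _ _)),
      pd_mul (hr _) (contDiff_sub_const _ _), pd_rpow hs hp]
    simp only [pd_regDist, pd_sub_const, if_true]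
    norm_num
    ring
  -- With `s` the regularised distance squared, summing gives `3 s^(-5/2) (s - δ) - 3 s^(-3/2)`. In
  -- dimension three the leading terms cancel and only the `δ` term survives.
  have h2 : regDist w δ x ^ (-3 / 2 : ℝ) = regDist w δ x ^ (-5 / 2 : ℝ) * regDist w δ x := by
    rw [← Real.rpow_add_one (hp x).ne']
    norm_num
  simp only [spatialLaplacian, h1, h2]
  rw [Finset.sum_sub_distrib, ← Finset.mul_sum]
  simp only [Finset.sum_const, Finset.card_univ, Fintype.card_fin, nsmul_eq_mul]
  have h3 : ∑ i : Fin 3, (x i.succ - w i) * (x i.succ - w i) = regDist w δ x - δ := by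
    simp [regDist]
  rw [h3]
  push_cast
  ring

/-- Green's second identity without boundary terms. -/
theorem integral_mul_spatialLaplacian {f g : Spacetime → ℝ} (hf : ContDiff ℝ ∞ f)
    (hg : ContDiff ℝ ∞ g) (hc : SliceCompact g) (t : ℝ) :
    ∫ x : Space, f (event t x) * spatialLaplacian g (event t x)
      = ∫ x : Space, spatialLaplacian f (event t x) * g (event t x) := by
  simp only [spatialLaplacian, Finset.mul_sum, Finset.sum_mul]
  rw [integral_finsetSum, integral_finsetSum]
  · refine Finset.sum_congr rfl fun i _ => ?_
    rw [integral_mul_pd_succ hf (contDiff_pd hg _) (hc.pd _),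
      integral_mul_pd_succ (contDiff_pd hf _) hg hc, neg_neg]
  · exact fun i _ => (hc.mul_left _).integrable
      ((contDiff_pd (contDiff_pd hf _) _).mul hg).continuous t
  · exact fun i _ => (((hc.pd _).pd _).mul_left _).integrable
      (hf.mul (contDiff_pd (contDiff_pd hg _) _)).continuous t

/-- A probability density whose rescalings are Laplacians of regularised Newtonian kernels. -/
noncomputable def newtonPeak (z : Space) : ℝ :=
  3 / (4 * Real.pi) * (1 + ‖z‖ ^ 2) ^ (-5 / 2 : ℝ)

theorem integral_Ioi_sq_mul_rpow :
    ∫ r in Set.Ioi (0 : ℝ), r ^ 2 * (1 + r ^ 2) ^ (-5 / 2 : ℝ) = 1 / 3 := by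
  have hpos : ∀ r : ℝ, 0 < 1 + r ^ 2 := fun r => by positivity
  have hd : ∀ r : ℝ, HasDerivAt (fun r : ℝ => 1 / 3 * (r ^ 3 * (1 + r ^ 2) ^ (-3 / 2 : ℝ)))
      (r ^ 2 * (1 + r ^ 2) ^ (-5 / 2 : ℝ)) r := fun r => by
    have h1 : HasDerivAt (fun r : ℝ => 1 + r ^ 2) (2 * r) r := by
      simpa using (hasDerivAt_pow 2 r).const_add 1
    have h2 := ((hasDerivAt_pow 3 r).mul
      (h1.rpow_const (p := -3 / 2) (Or.inl (hpos r).ne'))).const_mul (1 / 3)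
    refine h2.congr_deriv ?_
    have e : (1 + r ^ 2) ^ (-3 / 2 : ℝ) = (1 + r ^ 2) ^ (-5 / 2 : ℝ) * (1 + r ^ 2) := by
      rw [← Real.rpow_add_one (hpos r).ne']
      norm_num
    have e' : (-3 / 2 - 1 : ℝ) = -5 / 2 := by norm_num
    rw [e', e]
    push_cast
    ring
  have hl : Filter.Tendsto (fun r : ℝ => 1 / 3 * (r ^ 3 * (1 + r ^ 2) ^ (-3 / 2 : ℝ)))
      Filter.atTop (nhds (1 / 3)) := by
    -- For `r ≥ 0` the primitive is `1/3 * (1 - (1 + r²)⁻¹)^(3/2)`, whose limit is visible.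
    have a : Filter.Tendsto (fun r : ℝ => 1 - (1 + r ^ 2)⁻¹) Filter.atTop (nhds (1 - 0)) := by
      refine tendsto_const_nhds.sub (tendsto_inv_atTop_zero.comp ?_)
      exact Filter.tendsto_atTop_add_const_left _ _ (Filter.tendsto_pow_atTop two_ne_zero)
    have b := (a.rpow_const (p := 3 / 2) (Or.inr (by norm_num))).const_mul (1 / 3)
    rw [sub_zero, Real.one_rpow, mul_one] at b
    refine b.congr' ?_
    filter_upwards [Filter.eventually_ge_atTop 0] with r hr
    have e : 1 - (1 + r ^ 2)⁻¹ = r ^ 2 * (1 + r ^ 2)⁻¹ := by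
      have := (hpos r).ne'
      field_simp
      ring
    rw [e, Real.mul_rpow (by positivity) (by positivity), Real.inv_rpow (hpos r).le,
      ← Real.rpow_neg (hpos r).le, ← Real.rpow_natCast r 2, ← Real.rpow_mul hr,
      ← Real.rpow_natCast r 3]
    norm_num
  have := integral_Ioi_of_hasDerivAt_of_nonneg (a := 0)
    (hd 0).continuousAt.continuousWithinAt (fun r _ => hd r)
    (fun r _ => by positivity) hl
  rw [this]
  norm_num

theorem integral_newtonPeak : ∫ z : Space, newtonPeak z = 1 := by
  have h := integral_fun_norm_addHaar (volume : Measure Space)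
    (fun r : ℝ => 3 / (4 * Real.pi) * (1 + r ^ 2) ^ (-5 / 2 : ℝ))
  have hv : (volume : Measure Space).real (Metric.ball 0 1) = Real.pi * 4 / 3 := by
    rw [Measure.real, EuclideanSpace.volume_ball_fin_three]
    simp only [ENNReal.ofReal_one, one_pow, one_mul]
    exact ENNReal.toReal_ofReal (by positivity)
  have e : ∀ r : ℝ, r ^ 2 * (3 / (4 * Real.pi) * (1 + r ^ 2) ^ (-5 / 2 : ℝ))
      = 3 / (4 * Real.pi) * (r ^ 2 * (1 + r ^ 2) ^ (-5 / 2 : ℝ)) := fun r => by ring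
  unfold newtonPeak
  rw [h, hv, finrank_euclideanSpace_fin]
  simp only [smul_eq_mul, Nat.add_one_sub_one, e]
  rw [integral_const_mul, integral_Ioi_sq_mul_rpow]
  have := Real.pi_pos.ne'
  simp only [nsmul_eq_mul]
  field_simp
  norm_num

/-- The decay hypothesis of the approximate identity theorem: the product is at most a constant
times `(1 + ‖z‖²)⁻¹`. -/
theorem tendsto_norm_pow_mul_newtonPeak :
    Filter.Tendsto (fun z : Space => ‖z‖ ^ Module.finrank ℝ Space * newtonPeak z)
      (Bornology.cobounded Space) (nhds 0) := by
  rw [finrank_euclideanSpace_fin]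
  have h : Filter.Tendsto (fun z : Space => 3 / (4 * Real.pi) * (1 + ‖z‖ ^ 2)⁻¹)
      (Bornology.cobounded Space) (nhds (3 / (4 * Real.pi) * 0)) := by
    refine (tendsto_inv_atTop_zero.comp ?_).const_mul _
    exact Filter.tendsto_atTop_add_const_left _ _
      ((Filter.tendsto_pow_atTop two_ne_zero).comp tendsto_norm_cobounded_atTop)
  rw [mul_zero] at h
  refine squeeze_zero (fun z => by unfold newtonPeak; positivity) (fun z => ?_) h
  have hpos : 0 < 1 + ‖z‖ ^ 2 := by positivity
  have e : ‖z‖ ^ 3 ≤ (1 + ‖z‖ ^ 2) ^ (3 / 2 : ℝ) := by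
    have : ‖z‖ ^ 3 = (‖z‖ ^ 2) ^ (3 / 2 : ℝ) := by
      rw [← Real.rpow_natCast _ 2, ← Real.rpow_mul (norm_nonneg z), ← Real.rpow_natCast _ 3]
      norm_num
    rw [this]
    exact Real.rpow_le_rpow (by positivity) (by linarith) (by norm_num)
  have e2 : (1 + ‖z‖ ^ 2)⁻¹ = (1 + ‖z‖ ^ 2) ^ (3 / 2 : ℝ) * (1 + ‖z‖ ^ 2) ^ (-5 / 2 : ℝ) := by
    rw [← Real.rpow_add hpos, ← Real.rpow_neg_one]
    norm_num
  rw [newtonPeak, e2, mul_left_comm]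
  gcongr

/-- Regularise `1/|x - y|` to `(|x - y|² + c⁻²)^(-1/2)`. Green's identity moves the Laplacian to
this smooth kernel, where it becomes minus the rescaled density `c³ newtonPeak (c (x - y))`, an
approximate identity as `c → ∞`. The original integral is recovered by dominated convergence, the
Newtonian kernel itself dominating. -/
theorem sliceConv_newtonKernel_spatialLaplacian {g : Spacetime → ℝ} (hg : ContDiff ℝ ∞ g)
    (hc : SliceCompact g) (x : Spacetime) :
    sliceConv newtonKernel (spatialLaplacian g) x = -g x := by
  have hL := contDiff_spatialLaplacian hg
  have hLc := hc.spatialLaplacian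
  have hrhs := tendsto_integral_comp_smul_smul_of_integrable' (μ := (volume : Measure Space))
    (φ := newtonPeak) (fun z => by unfold newtonPeak; positivity) integral_newtonPeak
    tendsto_norm_pow_mul_newtonPeak (hc.integrable hg.continuous (x 0))
    (x₀ := spatial x) (hg.continuous.comp (continuous_event (x 0))).continuousAt
  rw [event_spatial] at hrhs
  have hlhs : Filter.Tendsto (fun c : ℝ => ∫ y : Space, (1 / (4 * Real.pi) *
      (regDist (spatial x) (c⁻¹ ^ 2) (event (x 0) y)) ^ (-1 / 2 : ℝ))
        * spatialLaplacian g (event (x 0) y))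
      Filter.atTop (nhds (sliceConv newtonKernel (spatialLaplacian g) x)) := by
    -- At `y = spatial x` the Newtonian kernel is `0` by convention and does not dominate its
    -- regularisation; this point is negligible.
    have hne : ∀ᵐ y : Space, y ≠ spatial x := by
      simp [ae_iff]
    refine tendsto_integral_filter_of_dominated_convergence
      (fun y => ‖newtonKernel (spatial x - y) * spatialLaplacian g (event (x 0) y)‖) ?_ ?_
      (integrable_newtonKernel_mul hL hLc _ _).norm ?_
    · filter_upwards [Filter.eventually_gt_atTop 0] with c hc0
      refine Continuous.aestronglyMeasurable ?_
      refine (continuous_const.mul ?_).mul (hL.continuous.comp (continuous_event _))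
      refine ((contDiff_regDist _ _).continuous.comp (continuous_event _)).rpow_const fun y => ?_
      exact Or.inl (regDist_pos _ (by positivity) _).ne'
    · filter_upwards [Filter.eventually_gt_atTop 0] with c hc0
      filter_upwards [hne] with y hy
      have hp : 0 < ‖spatial x - y‖ := norm_pos_iff.2 (sub_ne_zero_of_ne (Ne.symm hy))
      rw [norm_mul, norm_mul (newtonKernel _)]
      refine mul_le_mul_of_nonneg_right ?_ (norm_nonneg (spatialLaplacian g (event (x 0) y)))
      rw [regDist_event, newtonKernel_eq_rpow, Real.norm_of_nonneg (by positivity),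
        Real.norm_of_nonneg (by positivity)]
      refine mul_le_mul_of_nonneg_left ?_ (by positivity)
      exact Real.rpow_le_rpow_of_nonpos (by positivity) (by simp; positivity) (by norm_num)
    · filter_upwards [hne] with y hy
      have hp : 0 < ‖spatial x - y‖ := norm_pos_iff.2 (sub_ne_zero_of_ne (Ne.symm hy))
      refine Filter.Tendsto.mul_const _ ?_
      have h0 : Filter.Tendsto (fun c : ℝ => ‖spatial x - y‖ ^ 2 + c⁻¹ ^ 2) Filter.atTop
          (nhds (‖spatial x - y‖ ^ 2 + 0 ^ 2)) :=
        tendsto_const_nhds.add (tendsto_inv_atTop_zero.pow 2)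
      rw [zero_pow two_ne_zero, add_zero] at h0
      rw [newtonKernel_eq_rpow]
      simp only [regDist_event]
      exact (h0.rpow_const (Or.inl (by positivity))).const_mul _
  refine tendsto_nhds_unique hlhs (hrhs.neg.congr' ?_)
  filter_upwards [Filter.eventually_gt_atTop 0] with c hc0
  have hδ : 0 < c⁻¹ ^ 2 := by positivity
  have hr : ContDiff ℝ ∞ fun y => regDist (spatial x) (c⁻¹ ^ 2) y ^ (-1 / 2 : ℝ) :=
    (contDiff_regDist _ _).rpow_const_of_ne fun y => (regDist_pos _ hδ y).ne'
  have hgreen := integral_mul_spatialLaplacian hr hg hc (x 0)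
  simp only [mul_assoc (1 / (4 * Real.pi))]
  rw [integral_const_mul, hgreen, ← integral_const_mul, ← integral_neg]
  congr 1
  funext y
  rw [spatialLaplacian_regDist_rpow _ hδ, regDist_event, finrank_euclideanSpace_fin, newtonPeak,
    norm_smul, Real.norm_of_nonneg hc0.le]
  -- Scaling: the Jacobian `c³` times the factor `c⁻⁵` from the power `-5/2` is `c⁻² = δ`, the
  -- factor in the Laplacian.
  have e : 1 + (c * ‖spatial x - y‖) ^ 2 = c ^ 2 * (‖spatial x - y‖ ^ 2 + c⁻¹ ^ 2) := by
    field_simp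
    ring
  have e2 : (c ^ 2) ^ (-5 / 2 : ℝ) = (c ^ 5)⁻¹ := by
    rw [← Real.rpow_natCast _ 2, ← Real.rpow_mul hc0.le, ← Real.rpow_natCast _ 5,
      ← Real.rpow_neg hc0.le]
    norm_num
  rw [e, Real.mul_rpow (by positivity) (by positivity), e2, smul_eq_mul]
  field_simp

theorem eq_zero_of_spatialLaplacian_eq_zero {g : Spacetime → ℝ} (hg : ContDiff ℝ ∞ g)
    (hc : SliceCompact g) (h : ∀ x, spatialLaplacian g x = 0) (x : Spacetime) : g x = 0 := by
  have := sliceConv_newtonKernel_spatialLaplacian hg hc x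
  simpa [sliceConv, h] using this.symm

/-! ### Weighted means of functions of one variable -/

/-- The weighted mean `∫_{-1}^1 (1 - s²)^n f(t + s r) ds`. -/
noncomputable def radialMean (n : ℕ) (f : ℝ → ℝ) (t r : ℝ) : ℝ :=
  ∫ s in (-1 : ℝ)..1, (1 - s ^ 2) ^ n * f (t + s * r)

theorem ContDiff.deriv_infty {f : ℝ → ℝ} (hf : ContDiff ℝ ∞ f) : ContDiff ℝ ∞ (deriv f) :=
  (contDiff_infty_iff_deriv.1 hf).2

theorem hasDerivAt_comp_affine {f : ℝ → ℝ} (hf : ContDiff ℝ ∞ f) (t r s : ℝ) :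
    HasDerivAt (fun s => f (t + s * r)) (deriv f (t + s * r) * r) s := by
  have h : HasDerivAt (fun s : ℝ => t + s * r) r s := by
    simpa using ((hasDerivAt_id s).mul_const r).const_add t
  exact ((hf.differentiable (by simp) _).hasDerivAt).comp s h

/-- Integration by parts; the weight `(1 - s²)^(n + 1)` vanishes at `±1`, so there are no boundary
terms. -/
theorem mul_radialMean_succ_deriv {f : ℝ → ℝ} (hf : ContDiff ℝ ∞ f) (n : ℕ) (t r : ℝ) :
    r * radialMean (n + 1) (deriv f) t r
      = 2 * (n + 1) * ∫ s in (-1 : ℝ)..1, (1 - s ^ 2) ^ n * (s * f (t + s * r)) := by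
  have hu : ∀ s : ℝ, HasDerivAt (fun s : ℝ => (1 - s ^ 2) ^ (n + 1))
      (-(2 * (n + 1)) * ((1 - s ^ 2) ^ n * s)) s := fun s => by
    refine (((hasDerivAt_pow 2 s).const_sub 1).pow (n + 1)).congr_deriv ?_
    push_cast
    simp
    ring
  have hc := hf.continuous
  have hc' := (ContDiff.deriv_infty hf).continuous
  have h := intervalIntegral.integral_mul_deriv_eq_deriv_mul (a := -1) (b := 1)
    (fun s _ => hu s) (fun s _ => hasDerivAt_comp_affine hf t r s)
    (Continuous.intervalIntegrable (by fun_prop) _ _)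
    (Continuous.intervalIntegrable (by fun_prop) _ _)
  have e : r * radialMean (n + 1) (deriv f) t r
      = ∫ s in (-1 : ℝ)..1, (1 - s ^ 2) ^ (n + 1) * (deriv f (t + s * r) * r) := by
    rw [radialMean, ← intervalIntegral.integral_const_mul]
    congr 1
    funext s
    ring
  rw [e, h, ← intervalIntegral.integral_const_mul, ← sub_eq_zero]
  simp only [one_pow, sub_self, even_two, Even.neg_pow, ne_eq, Nat.add_eq_zero_iff, one_ne_zero,
    and_false, not_false_eq_true, zero_pow, zero_mul, zero_sub]
  rw [← intervalIntegral.integral_neg, sub_eq_zero]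
  congr 1
  funext s
  ring

/-- Two integrations by parts, the second with the weight `(1 - s²) s`, again zero at `±1`, whose
derivative is `3 (1 - s²) - 2`. This identity is what turns the Laplacian of a spherical mean into
its second time derivative. -/
theorem radialMean_wave_identity {g : ℝ → ℝ} (hg : ContDiff ℝ ∞ g) (t r : ℝ) :
    r ^ 2 * radialMean 2 (deriv (deriv g)) t r
      = 8 * radialMean 0 g t r - 12 * radialMean 1 g t r := by
  have hc := hg.continuous
  have hc' := (ContDiff.deriv_infty hg).continuous
  have h1 := mul_radialMean_succ_deriv (ContDiff.deriv_infty hg) 1 t r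
  have hu : ∀ s : ℝ, HasDerivAt (fun s : ℝ => (1 - s ^ 2) * s) (1 - 3 * s ^ 2) s := fun s => by
    refine (((hasDerivAt_pow 2 s).const_sub 1).mul (hasDerivAt_id s)).congr_deriv ?_
    simp
    ring
  have h2 := intervalIntegral.integral_mul_deriv_eq_deriv_mul (a := -1) (b := 1)
    (fun s _ => hu s) (fun s _ => hasDerivAt_comp_affine hg t r s)
    (Continuous.intervalIntegrable (by fun_prop) _ _)
    (Continuous.intervalIntegrable (by fun_prop) _ _)
  have e : ∫ s in (-1 : ℝ)..1, (1 - s ^ 2) * s * (deriv g (t + s * r) * r)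
      = r * ∫ s in (-1 : ℝ)..1, (1 - s ^ 2) ^ 1 * (s * deriv g (t + s * r)) := by
    rw [← intervalIntegral.integral_const_mul]
    congr 1
    funext s
    ring
  have e2 : ∫ s in (-1 : ℝ)..1, (1 - 3 * s ^ 2) * g (t + s * r)
      = 3 * radialMean 1 g t r - 2 * radialMean 0 g t r := by
    rw [radialMean, radialMean, ← intervalIntegral.integral_const_mul,
      ← intervalIntegral.integral_const_mul, ← intervalIntegral.integral_sub]
    · congr 1
      funext s
      ring
    · exact Continuous.intervalIntegrable (by fun_prop) _ _
    · exact Continuous.intervalIntegrable (by fun_prop) _ _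
  rw [e, e2] at h2
  rw [sq, mul_assoc, h1]
  norm_num at h2 ⊢
  linarith

/-- The d'Alembert form of the wave: an incoming and an outgoing profile. Support and sign of the
wave are read off from it. -/
theorem mul_radialMean_zero_deriv {f : ℝ → ℝ} (hf : ContDiff ℝ ∞ f) (t r : ℝ) :
    r * radialMean 0 (deriv f) t r = f (t + r) - f (t - r) := by
  have hc' := (ContDiff.deriv_infty hf).continuous
  have h := intervalIntegral.integral_eq_sub_of_hasDerivAt (a := -1) (b := 1)
    (fun s _ => hasDerivAt_comp_affine hf t r s)
    (Continuous.intervalIntegrable (by fun_prop) _ _)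
  rw [intervalIntegral.integral_mul_const] at h
  simp only [radialMean, pow_zero, one_mul]
  rw [mul_comm, h]
  ring_nf

theorem radialMean_zero_of_odd {f : ℝ → ℝ} (hf : ∀ s, f (-s) = -f s) (n : ℕ) (r : ℝ) :
    radialMean n f 0 r = 0 := by
  have h : radialMean n f 0 r = -radialMean n f 0 r := by
    rw [radialMean, ← intervalIntegral.integral_neg]
    have := intervalIntegral.integral_comp_neg (a := -1) (b := 1)
      (fun s : ℝ => (1 - s ^ 2) ^ n * f (0 + s * r))
    rw [neg_neg] at this
    rw [← this]
    congr 1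
    funext s
    have := hf (s * r)
    simp [this]
  linarith

theorem deriv_neg_of_even {f : ℝ → ℝ} (hf : ∀ s, f (-s) = f s) (s : ℝ) :
    deriv f (-s) = -deriv f s := by
  have h := deriv_comp_neg f s
  simp only [hf] at h
  linarith

theorem deriv_neg_of_odd {f : ℝ → ℝ} (hf : ∀ s, f (-s) = -f s) (s : ℝ) :
    deriv f (-s) = deriv f s := by
  have h := deriv_comp_neg f s
  have e : deriv (fun x => -f x) s = -deriv f s := deriv.fun_neg
  simp only [hf] at h
  linarith

/-- Differentiating in `r` produces the weight `(1 - s²)^n s`; integrating by parts replaces it by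
`(1 - s²)^(n + 1)` and an explicit factor `r`. This factor makes the composition with `r = |y|`
differentiable at the origin. Compact support of `f` serves to bound `deriv f` uniformly. -/
theorem hasFDerivAt_radialMean {f : ℝ → ℝ} (hf : ContDiff ℝ ∞ f) (hs : HasCompactSupport f)
    (n : ℕ) (p : ℝ × ℝ) :
    HasFDerivAt (fun p : ℝ × ℝ => radialMean n f p.1 p.2)
      (radialMean n (deriv f) p.1 p.2 • ContinuousLinearMap.fst ℝ ℝ ℝ
        + (p.2 * (radialMean (n + 1) (deriv (deriv f)) p.1 p.2 / (2 * (n + 1)))) •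
          ContinuousLinearMap.snd ℝ ℝ ℝ) p := by
  have hc := hf.continuous
  have hc' := (ContDiff.deriv_infty hf).continuous
  obtain ⟨C, hC⟩ := hc'.bounded_above_of_compact_support hs.deriv
  have hB := mul_radialMean_succ_deriv (ContDiff.deriv_infty hf) n p.1 p.2
  let F' : ℝ × ℝ → ℝ → (ℝ × ℝ →L[ℝ] ℝ) := fun q s =>
    ((1 - s ^ 2) ^ n * deriv f (q.1 + s * q.2)) • ContinuousLinearMap.fst ℝ ℝ ℝ
      + ((1 - s ^ 2) ^ n * (s * deriv f (q.1 + s * q.2))) • ContinuousLinearMap.snd ℝ ℝ ℝ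
  have hF' : Continuous (F' p) := by fun_prop
  have key := intervalIntegral.hasFDerivAt_integral_of_dominated_of_fderiv_le
    (μ := volume) (a := -1) (b := 1) (s := Set.univ) (x₀ := p)
    (F := fun (q : ℝ × ℝ) s => (1 - s ^ 2) ^ n * f (q.1 + s * q.2)) (F' := F')
    (bound := fun _ => C + C) Filter.univ_mem
    (Filter.Eventually.of_forall fun q =>
      (Continuous.aestronglyMeasurable (by fun_prop)))
    (Continuous.intervalIntegrable (by fun_prop) _ _) hF'.aestronglyMeasurable
    (Filter.Eventually.of_forall fun s hs q _ => ?_)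
    (by simp) (Filter.Eventually.of_forall fun s hs q _ => ?_)
  · refine key.congr_fderiv ?_
    rw [intervalIntegral.integral_add, intervalIntegral.integral_smul_const,
      intervalIntegral.integral_smul_const, ← mul_div_assoc, hB, mul_div_cancel_left₀]
    · rfl
    · positivity
    · exact Continuous.intervalIntegrable (by fun_prop) _ _
    · exact Continuous.intervalIntegrable (by fun_prop) _ _
  · rw [Set.uIoc_of_le (by norm_num)] at hs
    have h1 : |(1 - s ^ 2) ^ n| ≤ 1 := by
      rw [abs_pow]
      refine pow_le_one₀ (abs_nonneg _) (abs_le.2 ⟨?_, ?_⟩) <;> nlinarith [hs.1, hs.2]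
    have h2 : |s| ≤ 1 := abs_le.2 ⟨hs.1.le, hs.2⟩
    have h3 := hC (q.1 + s * q.2)
    rw [Real.norm_eq_abs] at h3
    have h0 := (abs_nonneg _).trans h3
    refine (norm_add_le _ _).trans (add_le_add ?_ ?_)
    · rw [norm_smul, norm_mul, Real.norm_eq_abs, Real.norm_eq_abs]
      calc _ ≤ 1 * C * 1 := by gcongr; exact ContinuousLinearMap.norm_fst_le ℝ ℝ ℝ
        _ = C := by ring
    · rw [norm_smul, norm_mul, norm_mul, Real.norm_eq_abs, Real.norm_eq_abs, Real.norm_eq_abs]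
      calc _ ≤ 1 * (1 * C) * 1 := by gcongr; exact ContinuousLinearMap.norm_snd_le ℝ ℝ ℝ
        _ = C := by ring
  · have h1 : HasFDerivAt (fun q : ℝ × ℝ => q.1 + s * q.2)
        (ContinuousLinearMap.fst ℝ ℝ ℝ + s • ContinuousLinearMap.snd ℝ ℝ ℝ) q :=
      hasFDerivAt_fst.add (hasFDerivAt_snd.const_mul s)
    have h2 := (((hf.differentiable (by simp) (q.1 + s * q.2)).hasDerivAt.comp_hasFDerivAt q
      h1).const_mul ((1 - s ^ 2) ^ n))
    refine h2.congr_fderiv ?_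
    ext <;> simp [F', -mul_eq_mul_left_iff]
    ring

/-- A function of `(t, |y|)` is differentiable if its radial derivative vanishes linearly
at the origin. -/
theorem hasFDerivAt_comp_norm {φ : ℝ × ℝ → ℝ} {A B t : ℝ} {y : Space}
    (h : HasFDerivAt φ (A • ContinuousLinearMap.fst ℝ ℝ ℝ
      + (‖y‖ * B) • ContinuousLinearMap.snd ℝ ℝ ℝ) (t, ‖y‖)) :
    HasFDerivAt (fun q : ℝ × Space => φ (q.1, ‖q.2‖))
      (A • ContinuousLinearMap.fst ℝ ℝ Space
        + B • (innerSL ℝ y).comp (ContinuousLinearMap.snd ℝ ℝ Space)) (t, y) := by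
  rcases eq_or_ne y 0 with rfl | hy
  -- At the origin the norm is not differentiable, but the radial part of the derivative of `φ`
  -- vanishes there and `(s, y) ↦ (s, ‖y‖)` preserves the norm, so the little-o estimate transfers
  -- directly.
  · have hlim : Filter.Tendsto (fun q : ℝ × Space => (q.1, ‖q.2‖)) (nhds (t, 0))
        (nhds (t, ‖(0 : Space)‖)) :=
      Continuous.tendsto (f := fun q : ℝ × Space => (q.1, ‖q.2‖)) (by fun_prop) (t, 0)
    rw [hasFDerivAt_iff_isLittleO] at h ⊢
    have h2 := h.comp_tendsto hlim
    refine (h2.congr_left fun q => ?_).trans_le fun q => ?_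
    · simp
    · simp [Prod.norm_def]
  · have hn : HasFDerivAt (fun z : Space => ‖z‖) (‖y‖⁻¹ • innerSL ℝ y) y := by
      have h1 := (hasStrictFDerivAt_norm_sq y).hasFDerivAt.sqrt
        (pow_ne_zero 2 (norm_ne_zero_iff.2 hy))
      simp only [Real.sqrt_sq (norm_nonneg _)] at h1
      refine h1.congr_fderiv ?_
      ext z
      simp
      ring
    have h3 := h.comp (t, y) (f := fun q : ℝ × Space => (q.1, ‖q.2‖))
      (hasFDerivAt_fst.prodMk (hn.comp (t, y) hasFDerivAt_snd))
    refine h3.congr_fderiv ?_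
    have := norm_ne_zero_iff.2 hy
    ext <;> simp
    field_simp

/-! ### Spherical waves -/

/-- The function `radialMean n f (t, r)` of the time `t` and distance `r` to the event `a`.
For `n = 0` and `f = F'` this is the spherical wave `(F(t + r) - F(t - r)) / r`. -/
noncomputable def sphericalMean (a : Spacetime) (n : ℕ) (f : ℝ → ℝ) (x : Spacetime) : ℝ :=
  radialMean n f (x 0 - a 0) ‖spatial x - spatial a‖

theorem hasFDerivAt_sphericalMean (a : Spacetime) {f : ℝ → ℝ} (hf : ContDiff ℝ ∞ f)
    (hs : HasCompactSupport f) (n : ℕ) (x : Spacetime) :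
    HasFDerivAt (sphericalMean a n f)
      (sphericalMean a n (deriv f) x • (ContinuousLinearMap.proj 0 : Spacetime →L[ℝ] ℝ)
        + (sphericalMean a (n + 1) (deriv (deriv f)) x / (2 * (n + 1))) •
          (innerSL ℝ (spatialCLM x - spatialCLM a)).comp spatialCLM) x := by
  have h1 : HasFDerivAt (fun x : Spacetime => (x 0 - a 0, spatialCLM x - spatialCLM a))
      ((ContinuousLinearMap.proj 0 : Spacetime →L[ℝ] ℝ).prod spatialCLM) x :=
    ((hasFDerivAt_apply 0 x).sub_const _).prodMk (spatialCLM.hasFDerivAt.sub_const _)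
  have h2 := hasFDerivAt_comp_norm (hasFDerivAt_radialMean hf hs n
    (x 0 - a 0, ‖spatialCLM x - spatialCLM a‖))
  have h3 := h2.comp x h1
  refine h3.congr_fderiv ?_
  ext
  simp [sphericalMean, spatialCLM_apply]

/-- The derivative of a spherical mean is again built from spherical means, with other `n` and `f`;
hence the induction on the order with both generalised. -/
theorem contDiff_sphericalMean (a : Spacetime) {f : ℝ → ℝ} (hf : ContDiff ℝ ∞ f)
    (hs : HasCompactSupport f) (n : ℕ) : ContDiff ℝ ∞ (sphericalMean a n f) := by
  rw [contDiff_infty]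
  intro m
  induction m generalizing f n with
  | zero =>
    refine contDiff_zero.2 (continuous_iff_continuousAt.2 fun x => ?_)
    exact (hasFDerivAt_sphericalMean a hf hs n x).continuousAt
  | succ m ih =>
    refine contDiff_succ_iff_hasFDerivAt.2 ⟨_, ?_, hasFDerivAt_sphericalMean a hf hs n⟩
    have hf' := ContDiff.deriv_infty hf
    refine ((ih hf' hs.deriv n).smul contDiff_const).add (ContDiff.smul
      ((ih (ContDiff.deriv_infty hf') hs.deriv.deriv (n + 1)).div_const _) ?_)
    refine ContDiff.clm_comp ?_ contDiff_const
    exact (innerSL ℝ).contDiff.comp (spatialCLM.contDiff.sub contDiff_const)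

theorem pd_zero_sphericalMean (a : Spacetime) {f : ℝ → ℝ} (hf : ContDiff ℝ ∞ f)
    (hs : HasCompactSupport f) (n : ℕ) :
    pd 0 (sphericalMean a n f) = sphericalMean a n (deriv f) := by
  funext x
  have : spatial (Pi.single 0 1) = 0 := by
    ext i
    simp
  rw [pd_of_hasFDerivAt (hasFDerivAt_sphericalMean a hf hs n x)]
  simp [spatialCLM_apply, this]

theorem pd_succ_sphericalMean (a : Spacetime) {f : ℝ → ℝ} (hf : ContDiff ℝ ∞ f)
    (hs : HasCompactSupport f) (n : ℕ) (i : Fin 3) :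
    pd i.succ (sphericalMean a n f) = fun x => (1 / (2 * (n + 1))) *
      ((x i.succ - a i.succ) * sphericalMean a (n + 1) (deriv (deriv f)) x) := by
  funext x
  have : spatial (Pi.single i.succ 1) = EuclideanSpace.single i 1 := by
    ext j
    simp [Pi.single_apply]
  rw [pd_of_hasFDerivAt (hasFDerivAt_sphericalMean a hf hs n x)]
  simp [spatialCLM_apply, this, EuclideanSpace.inner_single_right]
  field_simp

/-- Writing `M_n` for the mean of weight `n`, the Laplacian is `3/2 M₁(f'') + 1/8 r² M₂(f'''')`,
which `radialMean_wave_identity` reduces to `M₀(f'')`, the second time derivative. -/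
theorem wave_sphericalMean (a : Spacetime) {f : ℝ → ℝ} (hf : ContDiff ℝ ∞ f)
    (hs : HasCompactSupport f) (x : Spacetime) :
    spatialLaplacian (sphericalMean a 0 f) x = pd 0 (pd 0 (sphericalMean a 0 f)) x := by
  have hf' := ContDiff.deriv_infty hf
  have hf2 := ContDiff.deriv_infty hf'
  have hs2 := hs.deriv.deriv
  have hW := contDiff_sphericalMean a hf2 hs2 (0 + 1)
  rw [pd_zero_sphericalMean a hf hs, pd_zero_sphericalMean a hf' hs.deriv]
  have hi : ∀ i : Fin 3, pd i.succ (pd i.succ (sphericalMean a 0 f)) x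
      = 1 / 2 * sphericalMean a 1 (deriv (deriv f)) x + 1 / 8 *
        ((x i.succ - a i.succ) ^ 2 * sphericalMean a 2 (deriv (deriv (deriv (deriv f)))) x) :=
    fun i => by
    rw [pd_succ_sphericalMean a hf hs, pd_smul _ ((contDiff_sub_const _ _).mul hW),
      pd_mul (contDiff_sub_const _ _) hW, pd_succ_sphericalMean a hf2 hs2]
    simp only [pd_sub_const]
    norm_num
    ring
  have hn : ∑ i : Fin 3, (x i.succ - a i.succ) ^ 2 = ‖spatial x - spatial a‖ ^ 2 := by
    rw [EuclideanSpace.norm_sq_eq]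
    simp
  have h := radialMean_wave_identity hf2 (x 0 - a 0) ‖spatial x - spatial a‖
  simp only [spatialLaplacian, hi]
  rw [Finset.sum_add_distrib, ← Finset.mul_sum, ← Finset.mul_sum, ← Finset.sum_mul, hn]
  simp only [sphericalMean] at h ⊢
  rw [h]
  simp
  ring

theorem sphericalMean_eq_zero (a : Spacetime) {F : ℝ → ℝ} (hF : ContDiff ℝ ∞ F) {R : ℝ}
    (hR : 0 ≤ R) (hs : ∀ s, R < |s| → F s = 0) {x : Spacetime}
    (hx : |x 0 - a 0| + R < ‖spatial x - spatial a‖) : sphericalMean a 0 (deriv F) x = 0 := by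
  have h := mul_radialMean_zero_deriv hF (x 0 - a 0) ‖spatial x - spatial a‖
  have h1 := le_abs_self (x 0 - a 0)
  have h2 := neg_abs_le (x 0 - a 0)
  rw [hs _ (lt_of_lt_of_le (by linarith) (le_abs_self _)),
    hs _ (lt_of_lt_of_le (by linarith) (neg_le_abs _)), sub_zero] at h
  exact (mul_eq_zero.1 h).resolve_left (by linarith [abs_nonneg (x 0 - a 0)])

/-- A base point `k` in the ball is found by moving from `a` a spatial distance at most `R` towards
`x`, and by one unit of time away from `x`. The time shift makes `x - k` nonzero, as required of
causal vectors. -/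
theorem mem_causalShadow_closedBall (a : Spacetime) {R : ℝ} (hR : 0 ≤ R) {x : Spacetime}
    (hx : ‖spatial x - spatial a‖ ≤ |x 0 - a 0| + R) :
    x ∈ causalShadow (Metric.closedBall a (R + 1)) := by
  obtain ⟨lam, hl0, hl1, hl2, hl3⟩ : ∃ lam : ℝ, 0 ≤ lam ∧ lam ≤ 1 ∧
      lam * ‖spatial x - spatial a‖ ≤ R ∧ (1 - lam) * ‖spatial x - spatial a‖ ≤ |x 0 - a 0| := by
    rcases le_or_gt ‖spatial x - spatial a‖ R with h | h
    · exact ⟨1, by norm_num, le_rfl, by simpa, by simp⟩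
    · have hp : 0 < ‖spatial x - spatial a‖ := hR.trans_lt h
      refine ⟨R / ‖spatial x - spatial a‖, by positivity, (div_le_one hp).2 h.le, ?_, ?_⟩
      · rw [div_mul_cancel₀ _ hp.ne']
      · rw [sub_mul, div_mul_cancel₀ _ hp.ne']
        linarith
  obtain ⟨σ, hσ, hσ'⟩ : ∃ σ : ℝ, |σ| ≤ 1 ∧ |x 0 - a 0 - σ| = |x 0 - a 0| + 1 := by
    rcases le_total 0 (x 0 - a 0) with h | h
    · exact ⟨-1, by simp, by rw [abs_of_nonneg h, abs_of_nonneg (by linarith)]; ring⟩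
    · exact ⟨1, by simp, by rw [abs_of_nonpos h, abs_of_nonpos (by linarith)]; ring⟩
  have hcoord : ∀ i : Fin 3, |x i.succ - a i.succ| ≤ ‖spatial x - spatial a‖ := fun i => by
    simpa using PiLp.norm_apply_le (spatial x - spatial a) i
  let k : Spacetime := Fin.cons (a 0 + σ) fun i => a i.succ + lam * (x i.succ - a i.succ)
  refine ⟨k, ?_, x - k, ⟨?_, ?_⟩, by simp⟩
  · rw [mem_closedBall_iff_norm, pi_norm_le_iff_of_nonneg (by linarith)]
    intro μ
    refine Fin.cases ?_ (fun i => ?_) μ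
    · simp only [k, Pi.sub_apply, Fin.cons_zero, add_sub_cancel_left, Real.norm_eq_abs]
      linarith
    · simp only [k, Pi.sub_apply, Fin.cons_succ, add_sub_cancel_left, Real.norm_eq_abs, abs_mul,
        abs_of_nonneg hl0]
      have := mul_le_mul_of_nonneg_left (hcoord i) hl0
      linarith
  · intro h0
    have : x 0 - a 0 - σ = 0 := by
      have := congrFun h0 0
      simp only [k, Pi.sub_apply, Fin.cons_zero, Pi.zero_apply] at this
      linarith
    rw [this, abs_zero] at hσ'
    linarith [abs_nonneg (x 0 - a 0)]
  · have e0 : (x - k) 0 = x 0 - a 0 - σ := by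
      simp only [k, Pi.sub_apply, Fin.cons_zero]
      ring
    have ei : ∀ i : Fin 3, (x - k) i.succ = (1 - lam) * (x i.succ - a i.succ) := fun i => by
      simp only [k, Pi.sub_apply, Fin.cons_succ]
      ring
    have hn : ∑ i : Fin 3, (x i.succ - a i.succ) ^ 2 = ‖spatial x - spatial a‖ ^ 2 := by
      rw [EuclideanSpace.norm_sq_eq]
      simp
    rw [Fin.sum_univ_succ]
    simp only [metric, Fin.succ_ne_zero, if_true, if_false, one_mul, e0, ei, mul_pow]
    rw [← Finset.mul_sum, hn, ← mul_pow, ← sq_abs (x 0 - a 0 - σ), hσ']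
    have h4 : 0 ≤ (1 - lam) * ‖spatial x - spatial a‖ :=
      mul_nonneg (by linarith) (norm_nonneg _)
    have := pow_le_pow_left₀ h4 (hl3.trans (le_add_of_nonneg_right zero_le_one)) 2
    linarith

theorem isSpaceCompact_of_eq_zero {ζ : Spacetime → Fin 4 → ℝ} (a : Spacetime) {R : ℝ}
    (hR : 0 ≤ R)
    (h : ∀ x, |x 0 - a 0| + R < ‖spatial x - spatial a‖ → ζ x = 0) : IsSpaceCompact ζ := by
  refine ⟨Metric.closedBall a (R + 1), isCompact_closedBall _ _, ?_⟩
  have hcl : IsClosed {x : Spacetime | ‖spatial x - spatial a‖ ≤ |x 0 - a 0| + R} :=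
    isClosed_le (continuous_spatial.sub continuous_const).norm
      ((((continuous_apply 0).sub continuous_const).abs).add continuous_const)
  refine (closure_minimal (fun x hx => ?_) hcl).trans
    fun x hx => mem_causalShadow_closedBall a hR hx
  by_contra hlt
  exact hx (h x (not_le.1 hlt))

/-! ### The field tensor and the Maxwell equation -/

theorem fieldTensor_antisymm (ζ : Spacetime → Fin 4 → ℝ) (μ ν : Fin 4) :
    fieldTensor ζ μ ν = fun x => -fieldTensor ζ ν μ x := by
  funext x
  simp [fieldTensor]

theorem fieldTensor_self (ζ : Spacetime → Fin 4 → ℝ) (μ : Fin 4) :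
    fieldTensor ζ μ μ = fun _ => 0 := by
  funext x
  simp [fieldTensor]

theorem sliceCompact_fieldTensor {ζ : Spacetime → Fin 4 → ℝ} (h : IsSpaceCompact ζ)
    (μ ν : Fin 4) : SliceCompact (fieldTensor ζ μ ν) :=
  ((h.sliceCompact ν).pd μ).sub ((h.sliceCompact μ).pd ν)

theorem contDiff_gradient {χ : Spacetime → ℝ} (hχ : ContDiff ℝ ∞ χ) :
    ContDiff ℝ ∞ (gradient χ) := contDiff_pi.2 fun μ => contDiff_pd hχ μ

theorem fieldTensor_gradient {χ : Spacetime → ℝ} (hχ : ContDiff ℝ ∞ χ) (μ ν : Fin 4) :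
    fieldTensor (gradient χ) μ ν = fun _ => 0 := by
  funext x
  exact sub_eq_zero.2 (congrFun (pd_comm hχ μ ν) x)

theorem fieldTensor_sub_gradient {ζ : Spacetime → Fin 4 → ℝ} (hζ : ContDiff ℝ ∞ ζ)
    {χ : Spacetime → ℝ} (hχ : ContDiff ℝ ∞ χ) (μ ν : Fin 4) :
    fieldTensor (ζ - gradient χ) μ ν = fieldTensor ζ μ ν := by
  funext x
  have h := congrFun (fieldTensor_gradient hχ μ ν) x
  simp only [fieldTensor] at h
  simp only [fieldTensor, Pi.sub_apply, pd_sub (contDiff_component hζ _)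
    (contDiff_component (contDiff_gradient hχ) _)]
  linarith

theorem SolvesMaxwell.gauss {ζ : Spacetime → Fin 4 → ℝ} (h : SolvesMaxwell ζ) (x : Spacetime) :
    ∑ i : Fin 3, pd i.succ (fieldTensor ζ 0 i.succ) x = 0 := by
  have h0 := h 0 x
  rw [Fin.sum_univ_succ] at h0
  simp only [metric, Fin.succ_ne_zero, if_true, if_false, fieldTensor_self, pd_const,
    fieldTensor_antisymm ζ (Fin.succ _) 0, pd_neg, Finset.sum_neg_distrib, one_mul] at h0
  linarith

theorem SolvesMaxwell.ampere {ζ : Spacetime → Fin 4 → ℝ} (h : SolvesMaxwell ζ) (k : Fin 3)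
    (x : Spacetime) :
    ∑ i : Fin 3, pd i.succ (fieldTensor ζ i.succ k.succ) x
      = pd 0 (fieldTensor ζ 0 k.succ) x := by
  have h0 := h k.succ x
  rw [Fin.sum_univ_succ] at h0
  simp only [metric, Fin.succ_ne_zero, if_true, if_false, one_mul] at h0
  linarith

theorem bianchi {ζ : Spacetime → Fin 4 → ℝ} (hζ : ContDiff ℝ ∞ ζ) (μ ν ρ : Fin 4)
    (x : Spacetime) :
    pd μ (fieldTensor ζ ν ρ) x + pd ν (fieldTensor ζ ρ μ) x + pd ρ (fieldTensor ζ μ ν) x = 0 := by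
  have hc := contDiff_component hζ
  have e : ∀ μ ν ρ, pd μ (fieldTensor ζ ν ρ) x
      = pd μ (pd ν fun y => ζ y ρ) x - pd μ (pd ρ fun y => ζ y ν) x := fun μ ν ρ =>
    congrFun (pd_sub (contDiff_pd (hc ρ) ν) (contDiff_pd (hc ν) ρ) μ) x
  rw [e, e, e, pd_comm (hc ρ) μ ν, pd_comm (hc μ) ν ρ, pd_comm (hc ν) ρ μ]
  ring

/-! ### Conservation of the current -/

theorem current_eq (ζ₁ ζ₂ : Spacetime → Fin 4 → ℝ) (μ : Fin 4) :
    current ζ₁ ζ₂ μ = fun x => ∑ ν, metric μ * metric ν *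
      (fieldTensor ζ₁ μ ν x * ζ₂ x ν - fieldTensor ζ₂ μ ν x * ζ₁ x ν) := by
  funext x
  refine Finset.sum_congr rfl fun ν _ => ?_
  ring

theorem contDiff_current_summand {ζ₁ ζ₂ : Spacetime → Fin 4 → ℝ} (h₁ : ContDiff ℝ ∞ ζ₁)
    (h₂ : ContDiff ℝ ∞ ζ₂) (μ ν : Fin 4) :
    ContDiff ℝ ∞ fun x => fieldTensor ζ₁ μ ν x * ζ₂ x ν - fieldTensor ζ₂ μ ν x * ζ₁ x ν :=
  ((contDiff_fieldTensor h₁ _ _).mul (contDiff_component h₂ _)).sub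
    ((contDiff_fieldTensor h₂ _ _).mul (contDiff_component h₁ _))

theorem contDiff_current {ζ₁ ζ₂ : Spacetime → Fin 4 → ℝ} (h₁ : ContDiff ℝ ∞ ζ₁)
    (h₂ : ContDiff ℝ ∞ ζ₂) (μ : Fin 4) : ContDiff ℝ ∞ (current ζ₁ ζ₂ μ) := by
  rw [current_eq]
  exact ContDiff.sum fun ν _ => contDiff_const.mul (contDiff_current_summand h₁ h₂ μ ν)

theorem sliceCompact_current {ζ₁ ζ₂ : Spacetime → Fin 4 → ℝ} (h₁ : IsSpaceCompact ζ₁)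
    (h₂ : IsSpaceCompact ζ₂) (μ : Fin 4) : SliceCompact (current ζ₁ ζ₂ μ) := by
  rw [current_eq]
  exact SliceCompact.sum _ fun ν => (((h₂.sliceCompact ν).mul_left _).sub
    ((h₁.sliceCompact ν).mul_left _)).mul_left _

/-- Terms containing the divergence of a field tensor vanish by Maxwell's equation. In the others
antisymmetry turns `F₁ · ∂ζ₂` into `½ F₁ · F₂`, which is symmetric in the two solutions and cancels.
-/
theorem sum_pd_current {ζ₁ ζ₂ : Spacetime → Fin 4 → ℝ} (h₁ : ContDiff ℝ ∞ ζ₁)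
    (h₂ : ContDiff ℝ ∞ ζ₂) (m₁ : SolvesMaxwell ζ₁) (m₂ : SolvesMaxwell ζ₂) (x : Spacetime) :
    ∑ μ, pd μ (current ζ₁ ζ₂ μ) x = 0 := by
  have hF₁ := contDiff_fieldTensor h₁
  have hF₂ := contDiff_fieldTensor h₂
  have hc₁ := contDiff_component h₁
  have hc₂ := contDiff_component h₂
  have e : ∀ μ, pd μ (current ζ₁ ζ₂ μ) x = ∑ ν, metric μ * metric ν *
      (pd μ (fieldTensor ζ₁ μ ν) x * ζ₂ x ν + fieldTensor ζ₁ μ ν x * pd μ (fun y => ζ₂ y ν) x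
        - (pd μ (fieldTensor ζ₂ μ ν) x * ζ₁ x ν
          + fieldTensor ζ₂ μ ν x * pd μ (fun y => ζ₁ y ν) x)) := fun μ => by
    rw [current_eq, pd_sum _ fun ν => contDiff_const.mul (contDiff_current_summand h₁ h₂ μ ν)]
    refine Finset.sum_congr rfl fun ν _ => ?_
    rw [pd_smul _ (contDiff_current_summand h₁ h₂ μ ν),
      pd_sub ((hF₁ μ ν).mul (hc₂ ν)) ((hF₂ μ ν).mul (hc₁ ν)), pd_mul (hF₁ μ ν) (hc₂ ν),
      pd_mul (hF₂ μ ν) (hc₁ ν)]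
  have a₁ := fun ν => m₁ ν x
  have a₂ := fun ν => m₂ ν x
  have f₁ : ∀ μ ν, fieldTensor ζ₁ μ ν x = pd μ (fun y => ζ₁ y ν) x - pd ν (fun y => ζ₁ y μ) x :=
    fun _ _ => rfl
  have f₂ : ∀ μ ν, fieldTensor ζ₂ μ ν x = pd μ (fun y => ζ₂ y ν) x - pd ν (fun y => ζ₂ y μ) x :=
    fun _ _ => rfl
  simp only [e, f₁, f₂]
  -- With all derivatives treated as free matrices, what remains is a polynomial identity in
  -- finitely many components.
  generalize hA : (fun μ ν => pd μ (fieldTensor ζ₁ μ ν) x) = A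
  generalize hB : (fun μ ν => pd μ (fieldTensor ζ₂ μ ν) x) = B
  generalize hP : (fun μ ν => pd μ (fun y => ζ₁ y ν) x) = P
  generalize hQ : (fun μ ν => pd μ (fun y => ζ₂ y ν) x) = Q
  simp only [fun μ ν => congrFun (congrFun hA μ) ν, fun μ ν => congrFun (congrFun hB μ) ν,
    fun μ ν => congrFun (congrFun hP μ) ν, fun μ ν => congrFun (congrFun hQ μ) ν] at a₁ a₂ ⊢
  have g0 : metric 0 = -1 := rfl
  have g1 : metric 1 = 1 := rfl
  have g2 : metric 2 = 1 := rfl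
  have g3 : metric 3 = 1 := rfl
  simp only [Fin.sum_univ_four, g0, g1, g2, g3] at a₁ a₂ ⊢
  linear_combination ζ₂ x 0 * a₁ 0 - ζ₂ x 1 * a₁ 1 - ζ₂ x 2 * a₁ 2 - ζ₂ x 3 * a₁ 3
    - ζ₁ x 0 * a₂ 0 + ζ₁ x 1 * a₂ 1 + ζ₁ x 2 * a₂ 2 + ζ₁ x 3 * a₂ 3

theorem flux_eq_flux (ζ₁ ζ₂ : solutionSpace) (s t : ℝ) : flux s ζ₁ ζ₂ = flux t ζ₁ ζ₂ := by
  obtain ⟨h₁, k₁, m₁⟩ := ζ₁.2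
  obtain ⟨h₂, k₂, m₂⟩ := ζ₂.2
  have hd : ∀ t, HasDerivAt (fun t => flux t ζ₁ ζ₂) 0 t := fun t => by
    refine (hasDerivAt_integral_slice (contDiff_current h₁ h₂ 0)
      (sliceCompact_current k₁ k₂ 0) t).congr_deriv ?_
    have e : ∀ x, pd 0 (current ζ₁ ζ₂ 0) x
        = -∑ i : Fin 3, pd i.succ (current ζ₁ ζ₂ i.succ) x := fun x => by
      have := sum_pd_current h₁ h₂ m₁ m₂ x
      rw [Fin.sum_univ_succ] at this
      linarith
    simp only [e]
    rw [integral_neg, integral_finsetSum _ fun i _ => ((sliceCompact_current k₁ k₂ _).pd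
      _).integrable (contDiff_pd (contDiff_current h₁ h₂ _) _).continuous t]
    simp only [integral_pd_succ (contDiff_current h₁ h₂ _) (sliceCompact_current k₁ k₂ _)]
    simp
  exact is_const_of_deriv_eq_zero (fun t => (hd t).differentiableAt) (fun t => (hd t).deriv) s t

/-! ### The Coulomb gauge -/

theorem contDiff_spatialDiv {ζ : Spacetime → Fin 4 → ℝ} (hζ : ContDiff ℝ ∞ ζ) :
    ContDiff ℝ ∞ (spatialDiv ζ) :=
  ContDiff.sum fun _ _ => contDiff_pd (contDiff_component hζ _) _

theorem sliceCompact_spatialDiv {ζ : Spacetime → Fin 4 → ℝ} (hζ : IsSpaceCompact ζ) :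
    SliceCompact (spatialDiv ζ) :=
  SliceCompact.sum _ fun _ => (hζ.sliceCompact _).pd _

theorem pd_spatialDiv {ζ : Spacetime → Fin 4 → ℝ} (hζ : ContDiff ℝ ∞ ζ) (μ : Fin 4) :
    pd μ (spatialDiv ζ) = fun x => ∑ i : Fin 3, pd i.succ (pd μ fun y => ζ y i.succ) x := by
  have hc := contDiff_component hζ
  have := pd_sum Finset.univ (fun i : Fin 3 => contDiff_pd (hc i.succ) i.succ) μ
  simp only [fun i : Fin 3 => pd_comm (hc i.succ) μ i.succ] at this
  exact this

theorem coulombPotential_eq (ζ : Spacetime → Fin 4 → ℝ) :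
    coulombPotential ζ = fun x => -sliceConv newtonKernel (spatialDiv ζ) x := rfl

theorem contDiff_coulombPotential {ζ : Spacetime → Fin 4 → ℝ} (hζ : ContDiff ℝ ∞ ζ)
    (hs : IsSpaceCompact ζ) : ContDiff ℝ ∞ (coulombPotential ζ) :=
  (contDiff_sliceConv locallyIntegrable_newtonKernel (contDiff_spatialDiv hζ)
    (sliceCompact_spatialDiv hs)).neg

theorem pd_coulombPotential {ζ : Spacetime → Fin 4 → ℝ} (hζ : ContDiff ℝ ∞ ζ)
    (hs : IsSpaceCompact ζ) (μ : Fin 4) (x : Spacetime) :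
    pd μ (coulombPotential ζ) x = -sliceConv newtonKernel (pd μ (spatialDiv ζ)) x := by
  rw [coulombPotential_eq, pd_neg, pd_sliceConv locallyIntegrable_newtonKernel
    (contDiff_spatialDiv hζ) (sliceCompact_spatialDiv hs)]

/-- Gauss's law is `∂₀ div ζ = Δζ₀`; thus a gauge function chosen for the spatial divergence also
removes the time component. -/
theorem pd_zero_coulombPotential {ζ : Spacetime → Fin 4 → ℝ} (hζ : ContDiff ℝ ∞ ζ)
    (hs : IsSpaceCompact ζ) (hm : SolvesMaxwell ζ) (x : Spacetime) :
    pd 0 (coulombPotential ζ) x = ζ x 0 := by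
  have hc := contDiff_component hζ
  have e : pd 0 (spatialDiv ζ) = spatialLaplacian fun y => ζ y 0 := by
    rw [pd_spatialDiv hζ]
    funext y
    have hg := hm.gauss y
    have h1 : ∀ i : Fin 3, pd i.succ (fieldTensor ζ 0 i.succ) y
        = pd i.succ (pd 0 fun y => ζ y i.succ) y - pd i.succ (pd i.succ fun y => ζ y 0) y :=
      fun i => congrFun (pd_sub (contDiff_pd (hc i.succ) 0) (contDiff_pd (hc 0) i.succ) i.succ) y
    simp only [h1, Finset.sum_sub_distrib] at hg
    exact sub_eq_zero.1 hg
  rw [pd_coulombPotential hζ hs, e,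
    sliceConv_newtonKernel_spatialLaplacian (hc 0) (hs.sliceCompact 0), neg_neg]

theorem spatialLaplacian_sliceConv {k : Space → ℝ} (hk : LocallyIntegrable k)
    {g : Spacetime → ℝ} (hg : ContDiff ℝ ∞ g) (hc : SliceCompact g) :
    spatialLaplacian (sliceConv k g) = sliceConv k (spatialLaplacian g) := by
  funext x
  have h2 : ∀ i : Fin 3, ContDiff ℝ ∞ (pd i.succ (pd i.succ g)) := fun i =>
    contDiff_pd (contDiff_pd hg _) _
  have hi : ∀ i : Fin 3, Integrable fun y : Space =>
      k (spatial x - y) * pd i.succ (pd i.succ g) (event (x 0) y) := fun i => by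
    have h := (((hc.pd i.succ).pd i.succ).hasCompactSupport (x 0)).convolutionExists_right
      (ContinuousLinearMap.mul ℝ ℝ) hk ((h2 i).continuous.comp (continuous_event (x 0))) (spatial x)
    exact convolutionExistsAt_iff_integrable_swap.1 h
  simp only [spatialLaplacian, pd_sliceConv hk hg hc,
    pd_sliceConv hk (contDiff_pd hg _) (hc.pd _), sliceConv, Finset.mul_sum]
  rw [integral_finsetSum _ fun i _ => hi i]

/-- The potential `χ` need not be slice-compact, so the Laplacian is first moved through the
convolution onto `div ζ`, to which the inversion formula applies. -/
theorem isCoulombGauge_coulombRep {ζ : Spacetime → Fin 4 → ℝ} (hζ : ContDiff ℝ ∞ ζ)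
    (hs : IsSpaceCompact ζ) (hm : SolvesMaxwell ζ) : IsCoulombGauge (coulombRep ζ) := by
  have hχ := contDiff_coulombPotential hζ hs
  have hD := contDiff_spatialDiv hζ
  have hDc := sliceCompact_spatialDiv hs
  refine ⟨fun x => ?_, fun x => ?_⟩
  · simp [coulombRep, gradient, pd_zero_coulombPotential hζ hs hm]
  · have e : spatialDiv (coulombRep ζ) x
        = spatialDiv ζ x - spatialLaplacian (coulombPotential ζ) x := by
      rw [spatialDiv, spatialDiv, spatialLaplacian, ← Finset.sum_sub_distrib]
      refine Finset.sum_congr rfl fun i _ => ?_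
      exact congrFun (pd_sub (contDiff_component hζ i.succ) (contDiff_pd hχ i.succ) i.succ) x
    have h1 : spatialLaplacian (coulombPotential ζ) x
        = -spatialLaplacian (sliceConv newtonKernel (spatialDiv ζ)) x := by
      simp only [coulombPotential_eq, spatialLaplacian, pd_neg, Finset.sum_neg_distrib]
    rw [e, h1, spatialLaplacian_sliceConv locallyIntegrable_newtonKernel hD hDc,
      sliceConv_newtonKernel_spatialLaplacian hD hDc]
    ring

theorem gaugeEquivalent_coulombRep {ζ : Spacetime → Fin 4 → ℝ} (hζ : ContDiff ℝ ∞ ζ)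
    (hs : IsSpaceCompact ζ) : GaugeEquivalent ζ (coulombRep ζ) :=
  ⟨coulombPotential ζ, contDiff_coulombPotential hζ hs, by simp [coulombRep]⟩

theorem solvesMaxwell_coulombRep {ζ : Spacetime → Fin 4 → ℝ} (hζ : ContDiff ℝ ∞ ζ)
    (hs : IsSpaceCompact ζ) (hm : SolvesMaxwell ζ) : SolvesMaxwell (coulombRep ζ) := by
  intro ν x
  simp only [coulombRep, fieldTensor_sub_gradient hζ (contDiff_coulombPotential hζ hs)]
  exact hm ν x

/-- A space-compact potential with vanishing field is a pure gauge, with Coulomb representative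
zero. -/
theorem coulombRep_eq_zero {ζ : Spacetime → Fin 4 → ℝ} (hζ : ContDiff ℝ ∞ ζ)
    (hs : IsSpaceCompact ζ) (hm : SolvesMaxwell ζ)
    (hF : ∀ i j : Fin 3, ∀ x, fieldTensor ζ i.succ j.succ x = 0) : coulombRep ζ = 0 := by
  have hc := contDiff_component hζ
  funext x μ
  refine Fin.cases ((isCoulombGauge_coulombRep hζ hs hm).1 x) (fun i => ?_) μ
  have e : pd i.succ (spatialDiv ζ) = spatialLaplacian fun y => ζ y i.succ := by
    rw [pd_spatialDiv hζ]
    funext y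
    refine Finset.sum_congr rfl fun j _ => ?_
    have : (pd i.succ fun y => ζ y j.succ) = pd j.succ fun y => ζ y i.succ := by
      funext z
      exact sub_eq_zero.1 (hF i j z)
    rw [this]
  simp only [coulombRep, gradient, Pi.sub_apply, Pi.zero_apply]
  rw [pd_coulombPotential hζ hs, e,
    sliceConv_newtonKernel_spatialLaplacian (hc i.succ) (hs.sliceCompact i.succ)]
  ring

/-! ### Test solutions with prescribed values on a time slice -/

/-- Both gauge conditions together give `∂^μ ξ_μ = 0`, which leaves the wave equation for each
component. -/
theorem solvesMaxwell_of_wave {ξ : Spacetime → Fin 4 → ℝ} (hξ : ContDiff ℝ ∞ ξ)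
    (h0 : ∀ x, ξ x 0 = 0) (hdiv : ∀ x, spatialDiv ξ x = 0)
    (hwave : ∀ ν x, spatialLaplacian (fun y => ξ y ν) x = pd 0 (pd 0 fun y => ξ y ν) x) :
    SolvesMaxwell ξ := by
  intro ν x
  have hc := contDiff_component hξ
  have e : ∀ μ, pd μ (fieldTensor ξ μ ν) x
      = pd μ (pd μ fun y => ξ y ν) x - pd ν (pd μ fun y => ξ y μ) x := fun μ => by
    rw [pd_comm (hc μ) ν μ]
    exact congrFun (pd_sub (contDiff_pd (hc ν) μ) (contDiff_pd (hc μ) ν) μ) x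
  have e0 : (fun y => ξ y 0) = fun _ => 0 := funext h0
  have ed : ∑ i : Fin 3, pd ν (pd i.succ fun y => ξ y i.succ) x = 0 := by
    have h := congrFun (pd_sum Finset.univ (fun i : Fin 3 => contDiff_pd (hc i.succ) i.succ) ν) x
    have hz : (fun y => ∑ i : Fin 3, pd i.succ (fun y => ξ y i.succ) y) = fun _ => 0 :=
      funext hdiv
    rw [hz, pd_const] at h
    exact h.symm
  have hw := hwave ν x
  rw [spatialLaplacian] at hw
  rw [Fin.sum_univ_succ]
  simp only [metric, Fin.succ_ne_zero, if_true, if_false, one_mul, e, Finset.sum_sub_distrib,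
    ed, hw, e0, pd_const]
  ring

theorem spatialLaplacian_pd {u : Spacetime → ℝ} (hu : ContDiff ℝ ∞ u) (μ : Fin 4) :
    spatialLaplacian (pd μ u) = pd μ (spatialLaplacian u) := by
  have h := pd_sum Finset.univ
    (fun i : Fin 3 => contDiff_pd (contDiff_pd hu i.succ) i.succ) μ
  refine Eq.trans ?_ h.symm
  funext x
  refine Finset.sum_congr rfl fun i _ => ?_
  rw [pd_comm hu i.succ μ, pd_comm (contDiff_pd hu _) i.succ μ]

theorem pd_mul_sub_mul {f g : Spacetime → ℝ} (hf : ContDiff ℝ ∞ f) (hg : ContDiff ℝ ∞ g)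
    (A B : ℝ) (μ : Fin 4) :
    pd μ (fun y => A * f y - B * g y) = fun x => A * pd μ f x - B * pd μ g x := by
  rw [pd_sub (contDiff_const.mul hf) (contDiff_const.mul hg), pd_smul _ hf, pd_smul _ hg]

/-- The potential with spatial components `ξ_k = ∂_l u`, `ξ_l = -∂_k u`, the others zero. -/
noncomputable def curlPotential (k l : Fin 3) (u : Spacetime → ℝ) (x : Spacetime) (μ : Fin 4) :
    ℝ :=
  (if μ = k.succ then 1 else 0) * pd l.succ u x - (if μ = l.succ then 1 else 0) * pd k.succ u x

theorem contDiff_curlPotential (k l : Fin 3) {u : Spacetime → ℝ} (hu : ContDiff ℝ ∞ u) :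
    ContDiff ℝ ∞ (curlPotential k l u) :=
  contDiff_pi.2 fun _ => (contDiff_const.mul (contDiff_pd hu _)).sub
    (contDiff_const.mul (contDiff_pd hu _))

theorem pd_curlPotential (k l : Fin 3) {u : Spacetime → ℝ} (hu : ContDiff ℝ ∞ u) (μ ν : Fin 4) :
    pd μ (fun y => curlPotential k l u y ν) = fun x =>
      (if ν = k.succ then 1 else 0) * pd μ (pd l.succ u) x
        - (if ν = l.succ then 1 else 0) * pd μ (pd k.succ u) x :=
  pd_mul_sub_mul (contDiff_pd hu _) (contDiff_pd hu _) _ _ _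

theorem solvesMaxwell_curlPotential (k l : Fin 3) {u : Spacetime → ℝ} (hu : ContDiff ℝ ∞ u)
    (hw : ∀ x, spatialLaplacian u x = pd 0 (pd 0 u) x) :
    SolvesMaxwell (curlPotential k l u) := by
  have hp := contDiff_pd hu
  refine solvesMaxwell_of_wave (contDiff_curlPotential k l hu) (fun x => ?_) (fun x => ?_)
    fun ν x => ?_
  · simp [curlPotential, (Fin.succ_ne_zero _).symm]
  · simp only [spatialDiv, pd_curlPotential k l hu, Fin.succ_inj, ite_mul, one_mul, zero_mul,
      Finset.sum_sub_distrib, Finset.sum_ite_eq', Finset.mem_univ, if_true]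
    rw [pd_comm hu, sub_self]
  · have hw' : spatialLaplacian u = pd 0 (pd 0 u) := funext hw
    have e : ∀ μ : Fin 4, spatialLaplacian (pd μ u) x = pd 0 (pd 0 (pd μ u)) x := fun μ => by
      rw [spatialLaplacian_pd hu, hw', pd_comm (hp 0), pd_comm hu]
    simp only [spatialLaplacian] at e
    simp only [spatialLaplacian, pd_curlPotential k l hu,
      pd_mul_sub_mul (contDiff_pd (hp _) _) (contDiff_pd (hp _) _), Finset.sum_sub_distrib,
      ← Finset.mul_sum, e]

theorem isSpaceCompact_curlPotential (k l : Fin 3) {u : Spacetime → ℝ} (a : Spacetime) {R : ℝ}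
    (hR : 0 ≤ R) (h : ∀ x, |x 0 - a 0| + R < ‖spatial x - spatial a‖ → u x = 0) :
    IsSpaceCompact (curlPotential k l u) := by
  refine isSpaceCompact_of_eq_zero a hR fun x hx => ?_
  have hU : IsOpen {x : Spacetime | |x 0 - a 0| + R < ‖spatial x - spatial a‖} :=
    isOpen_lt ((((continuous_apply 0).sub continuous_const).abs).add continuous_const)
      (continuous_spatial.sub continuous_const).norm
  have hz : u =ᶠ[nhds x] fun _ => 0 := Filter.eventually_of_mem (hU.mem_nhds hx) h
  funext μ
  simp [curlPotential, pd, hz.fderiv_eq]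

/-- Spherical waves momentarily at rest at the time of the event `a`, with a profile concentrated
near `a`. -/
theorem exists_sphericalWave (a : Spacetime) {R : ℝ} (hR : 0 < R) :
    ∃ u : Spacetime → ℝ, ContDiff ℝ ∞ u ∧
      (∀ x, |x 0 - a 0| + R < ‖spatial x - spatial a‖ → u x = 0) ∧
      (∀ x, spatialLaplacian u x = pd 0 (pd 0 u) x) ∧
      (∀ i : Fin 3, ∀ y, pd 0 (pd i.succ u) (event (a 0) y) = 0) ∧
      (∀ y, 0 ≤ u (event (a 0) y)) ∧ 0 < u a := by
  let b : ContDiffBump (0 : ℝ) := ⟨R / 2, R, by linarith, by linarith⟩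
  -- Since `F` is odd, the wave on the slice of `a` is `2 b(r)`: nonnegative, equal to `2` at the
  -- centre and with zero time derivative.
  let F : ℝ → ℝ := fun r => r * b r
  have hF : ContDiff ℝ ∞ F := contDiff_id.mul b.contDiff
  have hFc : HasCompactSupport F := b.hasCompactSupport.mul_left
  have hFo : ∀ r, F (-r) = -F r := fun r => by simp [F, b.neg]
  have hFz : ∀ r, R < |r| → F r = 0 := fun r hr => by
    have : b r = 0 := b.zero_of_le_dist (by simpa [Real.dist_eq] using hr.le)
    simp [F, this]
  have hf := ContDiff.deriv_infty hF
  have hfe := deriv_neg_of_odd hFo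
  have hval : ∀ y : Space, sphericalMean a 0 (deriv F) (event (a 0) y)
      = radialMean 0 (deriv F) 0 ‖y - spatial a‖ := fun y => by simp [sphericalMean]
  have hcenter : radialMean 0 (deriv F) 0 0 = 2 := by
    have h1 : HasDerivAt F (1 * b 0 + 0 * deriv b 0) 0 :=
      (hasDerivAt_id (0 : ℝ)).mul
        ((b.contDiff (n := 1)).differentiable one_ne_zero 0).hasDerivAt
    have hb : b 0 = 1 := b.one_of_mem_closedBall (by simp [b]; linarith)
    have h2 : deriv F 0 = 1 := by rw [h1.deriv, hb]; ring
    simp [radialMean, h2]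
    norm_num
  refine ⟨sphericalMean a 0 (deriv F), contDiff_sphericalMean a hf hFc.deriv 0,
    fun x hx => sphericalMean_eq_zero a hF hR.le hFz hx, wave_sphericalMean a hf hFc.deriv,
    fun i y => ?_, fun y => ?_, ?_⟩
  · rw [pd_comm (contDiff_sphericalMean a hf hFc.deriv 0), pd_zero_sphericalMean a hf hFc.deriv,
      pd_succ_sphericalMean a (ContDiff.deriv_infty hf) hFc.deriv.deriv]
    -- Parity alternates under differentiation: `F` is odd, so its fourth derivative, which occurs
    -- here, is odd and has zero mean at time difference `0`.
    have ho := deriv_neg_of_even (deriv_neg_of_odd (deriv_neg_of_even hfe))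
    simp [sphericalMean, radialMean_zero_of_odd ho]
  · rw [hval]
    rcases eq_or_ne y (spatial a) with rfl | hy
    · rw [sub_self, norm_zero, hcenter]
      norm_num
    · have hp : 0 < ‖y - spatial a‖ := norm_pos_iff.2 (sub_ne_zero_of_ne hy)
      have h := mul_radialMean_zero_deriv hF 0 ‖y - spatial a‖
      rw [zero_add, zero_sub, hFo, sub_neg_eq_add] at h
      have hFn : 0 ≤ F ‖y - spatial a‖ := mul_nonneg hp.le b.nonneg
      exact nonneg_of_mul_nonneg_right (by rw [h]; linarith) hp
  · have := hval (spatial a)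
    rw [event_spatial, sub_self, norm_zero, hcenter] at this
    rw [this]
    norm_num

/-- A continuous function whose integrals against all sufficiently concentrated spherical profiles
vanish is zero. -/
theorem eq_zero_of_integral_sphericalWave {h : Spacetime → ℝ} (hh : Continuous h)
    (a : Spacetime)
    (hint : ∀ (u : Spacetime → ℝ) (R : ℝ), 0 < R → ContDiff ℝ ∞ u →
      (∀ x, |x 0 - a 0| + R < ‖spatial x - spatial a‖ → u x = 0) →
      (∀ x, spatialLaplacian u x = pd 0 (pd 0 u) x) →
      (∀ i : Fin 3, ∀ y, pd 0 (pd i.succ u) (event (a 0) y) = 0) →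
      ∫ y : Space, h (event (a 0) y) * u (event (a 0) y) = 0) : h a = 0 := by
  by_contra hne
  have hcont : Continuous fun y : Space => h a * h (event (a 0) y) :=
    continuous_const.mul (hh.comp (continuous_event _))
  have hpos : 0 < h a * h (event (a 0) (spatial a)) := by
    rw [event_spatial]
    exact mul_self_pos.2 hne
  obtain ⟨R, hR, hball⟩ := Metric.eventually_nhds_iff.1
    -- On this ball `h` has the sign of `h a`; a wave of radius `R / 2` then makes the integral
    -- strictly positive.
    (hcont.continuousAt.eventually (lt_mem_nhds hpos))
  obtain ⟨u, hu, hz, hw, hr, hn, hp⟩ := exists_sphericalWave a (half_pos hR)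
  have h1 := hint u (R / 2) (half_pos hR) hu hz hw hr
  have hz' : ∀ y : Space, R / 2 < dist y (spatial a) → u (event (a 0) y) = 0 := fun y hy => by
    refine hz _ ?_
    simpa [dist_eq_norm] using hy
  have h2 : 0 < ∫ y : Space, h a * h (event (a 0) y) * u (event (a 0) y) := by
    refine Continuous.integral_pos_of_hasCompactSupport_nonneg_nonzero (x := spatial a)
      (hcont.mul (hu.continuous.comp (continuous_event _))) ?_ (fun y => ?_) ?_
    · refine HasCompactSupport.intro (isCompact_closedBall (spatial a) (R / 2)) fun y hy => ?_
      rw [hz' y (by simpa using hy), mul_zero]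
    · rcases lt_or_ge (R / 2) (dist y (spatial a)) with hy | hy
      · simp [hz' y hy]
      · exact mul_nonneg (hball (by linarith)).le (hn y)
    · rw [event_spatial] at hpos ⊢
      exact (mul_pos hpos hp).ne'
  simp only [mul_assoc] at h2
  rw [integral_const_mul, h1, mul_zero] at h2
  exact lt_irrefl _ h2

/-! ### The kernel of the presymplectic form -/

theorem current_zero_eq (ζ₁ ζ₂ : Spacetime → Fin 4 → ℝ) (x : Spacetime) :
    current ζ₁ ζ₂ 0 x = ∑ i : Fin 3, (ζ₁ x i.succ * fieldTensor ζ₂ 0 i.succ x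
      - ζ₂ x i.succ * fieldTensor ζ₁ 0 i.succ x) := by
  rw [current_zero]
  refine Finset.sum_congr rfl fun i _ => ?_
  simp only [fieldTensor]
  ring

/-- The field of `∂χ` vanishes, leaving `∂χ` paired with the electric field of `ξ`; by parts this
becomes `χ` times a divergence that Gauss's law annihilates. -/
theorem omega_eq_zero_of_gradient {ζ : solutionSpace} {χ : Spacetime → ℝ} (hχ : ContDiff ℝ ∞ χ)
    (h : (ζ : Spacetime → Fin 4 → ℝ) = gradient χ) (ξ : solutionSpace) : omega ζ ξ = 0 := by
  obtain ⟨hs, hk, hm⟩ := ξ.2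
  have hF := fun i : Fin 3 => contDiff_fieldTensor hs 0 i.succ
  have hFc := fun i : Fin 3 => sliceCompact_fieldTensor hk 0 i.succ
  change flux 0 ζ ξ = 0
  simp only [flux, current_zero_eq, h, fieldTensor_gradient hχ, mul_zero, sub_zero, gradient]
  rw [integral_finsetSum _ fun i _ => ((hFc i).mul_left _).integrable
    ((contDiff_pd hχ _).mul (hF i)).continuous 0]
  have e : ∀ i : Fin 3, ∫ x : Space, pd i.succ χ (event 0 x) * fieldTensor ξ 0 i.succ (event 0 x)
      = -∫ x : Space, χ (event 0 x) * pd i.succ (fieldTensor ξ 0 i.succ) (event 0 x) := fun i => by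
    rw [integral_mul_pd_succ hχ (hF i) (hFc i), neg_neg]
  simp only [e, Finset.sum_neg_distrib]
  rw [← integral_finsetSum _ fun i _ => (((hFc i).pd _).mul_left _).integrable
    (hχ.mul (contDiff_pd (hF i) _)).continuous 0]
  simp [← Finset.mul_sum, hm.gauss]

/-- The flux against a test solution at rest tests the curl of the electric field. -/
theorem flux_curlPotential {ζ : Spacetime → Fin 4 → ℝ} (hζ : ContDiff ℝ ∞ ζ)
    (hs : IsSpaceCompact ζ) (k l : Fin 3) {u : Spacetime → ℝ} (hu : ContDiff ℝ ∞ u) {t : ℝ}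
    (hr : ∀ i : Fin 3, ∀ y, pd 0 (pd i.succ u) (event t y) = 0) :
    flux t ζ (curlPotential k l u) = ∫ y : Space, (pd l.succ (fieldTensor ζ 0 k.succ) (event t y)
      - pd k.succ (fieldTensor ζ 0 l.succ) (event t y)) * u (event t y) := by
  have hF := fun i : Fin 3 => contDiff_fieldTensor hζ 0 i.succ
  have hFc := fun i : Fin 3 => sliceCompact_fieldTensor hs 0 i.succ
  have h0 : ∀ (i : Fin 3) (y : Space),
      fieldTensor (curlPotential k l u) 0 i.succ (event t y) = 0 := fun i y => by
    simp only [fieldTensor, pd_curlPotential k l hu, hr, (Fin.succ_ne_zero _).symm, if_false]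
    ring
  have e : ∀ y : Space, current ζ (curlPotential k l u) 0 (event t y)
      = pd k.succ u (event t y) * fieldTensor ζ 0 l.succ (event t y)
        - pd l.succ u (event t y) * fieldTensor ζ 0 k.succ (event t y) := fun y => by
    rw [current_zero_eq]
    simp only [h0, curlPotential, Fin.succ_inj, mul_zero, zero_sub, sub_mul, ite_mul, one_mul,
      zero_mul, neg_sub, Finset.sum_sub_distrib, Finset.sum_ite_eq', Finset.mem_univ, if_true]
  have hi : ∀ i j : Fin 3, Integrable fun y : Space =>
      pd i.succ u (event t y) * fieldTensor ζ 0 j.succ (event t y) := fun i j =>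
    ((hFc j).mul_left _).integrable ((contDiff_pd hu _).mul (hF j)).continuous t
  have hj : ∀ i j : Fin 3, Integrable fun y : Space =>
      u (event t y) * pd i.succ (fieldTensor ζ 0 j.succ) (event t y) := fun i j =>
    (((hFc j).pd _).mul_left _).integrable (hu.mul (contDiff_pd (hF j) _)).continuous t
  simp only [flux, e, mul_comm _ (u _), mul_sub]
  rw [integral_sub (hi k l) (hi l k), integral_sub (hj l k) (hj k l),
    integral_mul_pd_succ hu (hF k) (hFc k), integral_mul_pd_succ hu (hF l) (hFc l)]
  ring

/-- The form is evaluated on the slice through `a`, where the test wave is at rest, and conservation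
of the flux brings it back to time `0`. -/
theorem pd_electric_comm {ζ : solutionSpace} (h : ∀ ξ, omega ζ ξ = 0) (k l : Fin 3)
    (a : Spacetime) :
    pd l.succ (fieldTensor ζ 0 k.succ) a = pd k.succ (fieldTensor ζ 0 l.succ) a := by
  obtain ⟨hs, hk, -⟩ := ζ.2
  refine sub_eq_zero.1 (eq_zero_of_integral_sphericalWave
    (h := fun x => pd l.succ (fieldTensor ζ 0 k.succ) x - pd k.succ (fieldTensor ζ 0 l.succ) x)
    ((contDiff_pd (contDiff_fieldTensor hs _ _) _).sub
      (contDiff_pd (contDiff_fieldTensor hs _ _) _)).continuous a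
    fun u R hR hu hz hw hr => ?_)
  let ξ : solutionSpace := ⟨curlPotential k l u, contDiff_curlPotential k l hu,
    isSpaceCompact_curlPotential k l a hR.le hz, solvesMaxwell_curlPotential k l hu hw⟩
  rw [← flux_curlPotential hs hk k l hu hr]
  exact (flux_eq_flux ζ ξ (a 0) 0).trans (h ξ)

/-- Zero curl and divergence make the slice-compact electric field harmonic, hence zero. Ampère's
law then has no displacement term, so the magnetic tensor is divergence-free; with the Bianchi
identity it is harmonic and vanishes as well. -/
theorem coulombRep_eq_zero_of_omega {ζ : solutionSpace} (h : ∀ ξ, omega ζ ξ = 0) :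
    coulombRep ζ = 0 := by
  obtain ⟨hs, hk, hm⟩ := ζ.2
  have hF := contDiff_fieldTensor hs
  have hFc := sliceCompact_fieldTensor hk
  have hE : ∀ (i : Fin 3) (x : Spacetime), fieldTensor ζ 0 i.succ x = 0 := fun i =>
    eq_zero_of_spatialLaplacian_eq_zero (hF _ _) (hFc _ _) fun x => by
      have e : ∀ j : Fin 3, pd j.succ (fieldTensor ζ 0 i.succ)
          = pd i.succ (fieldTensor ζ 0 j.succ) := fun j => funext fun y => pd_electric_comm h i j y
      have hg : (fun y => ∑ j : Fin 3, pd j.succ (fieldTensor ζ 0 j.succ) y) = fun _ => 0 :=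
        funext hm.gauss
      have hd := congrFun (pd_sum Finset.univ
        (fun j : Fin 3 => contDiff_pd (hF 0 j.succ) j.succ) i.succ) x
      rw [hg, pd_const] at hd
      refine Eq.trans ?_ hd.symm
      refine Finset.sum_congr rfl fun j _ => ?_
      rw [e j, pd_comm (hF 0 j.succ)]
  have hE' : ∀ i : Fin 3, fieldTensor ζ 0 i.succ = fun _ => 0 := fun i => funext (hE i)
  have hA : ∀ k : Fin 3,
      (fun y => ∑ i : Fin 3, pd i.succ (fieldTensor ζ i.succ k.succ) y) = fun _ => 0 := fun k => by
    funext y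
    rw [hm.ampere k y, hE', pd_const]
  have hD : ∀ (k l : Fin 3) (x : Spacetime),
      ∑ i : Fin 3, pd l.succ (pd i.succ (fieldTensor ζ i.succ k.succ)) x = 0 := fun k l x => by
    have hd := congrFun (pd_sum Finset.univ
      (fun i : Fin 3 => contDiff_pd (hF i.succ k.succ) i.succ) l.succ) x
    rw [hA, pd_const] at hd
    exact hd.symm
  refine coulombRep_eq_zero hs hk hm fun j k =>
    eq_zero_of_spatialLaplacian_eq_zero (hF _ _) (hFc _ _) fun x => ?_
  have hb : ∀ i : Fin 3, pd i.succ (fieldTensor ζ j.succ k.succ) = fun y =>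
      pd j.succ (fieldTensor ζ i.succ k.succ) y - pd k.succ (fieldTensor ζ i.succ j.succ) y :=
    fun i => by
    funext y
    have h1 := bianchi hs i.succ j.succ k.succ y
    rw [fieldTensor_antisymm ζ k.succ i.succ, pd_neg] at h1
    linarith
  have hi : ∀ i : Fin 3, pd i.succ (pd i.succ (fieldTensor ζ j.succ k.succ)) x
      = pd j.succ (pd i.succ (fieldTensor ζ i.succ k.succ)) x
        - pd k.succ (pd i.succ (fieldTensor ζ i.succ j.succ)) x := fun i => by
    rw [hb i, pd_sub (contDiff_pd (hF _ _) _) (contDiff_pd (hF _ _) _),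
      pd_comm (hF _ _) i.succ j.succ, pd_comm (hF _ _) i.succ k.succ]
  simp only [spatialLaplacian, hi, Finset.sum_sub_distrib, hD, sub_zero]

theorem mem_ker_omega_iff (ζ : solutionSpace) :
    ζ ∈ LinearMap.ker omega ↔ ∀ ξ, omega ζ ξ = 0 := by
  rw [LinearMap.mem_ker]
  exact ⟨fun h ξ => by rw [h]; rfl, fun h => LinearMap.ext h⟩

theorem tfae_mem_ker_omega (ζ : solutionSpace) : List.TFAE [
    ζ ∈ LinearMap.ker omega,
    coulombRep ζ = 0,
    ∃ χ : Spacetime → ℝ, ContDiff ℝ ∞ χ ∧ (ζ : Spacetime → Fin 4 → ℝ) = gradient χ] := by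
  obtain ⟨hs, hk, -⟩ := ζ.2
  tfae_have 1 → 2 := fun h => coulombRep_eq_zero_of_omega ((mem_ker_omega_iff ζ).1 h)
  tfae_have 2 → 3 := fun h => ⟨_, contDiff_coulombPotential hs hk, sub_eq_zero.1 h⟩
  tfae_have 3 → 1 := fun ⟨_, hχ, h⟩ =>
    (mem_ker_omega_iff ζ).2 (omega_eq_zero_of_gradient hχ h)
  tfae_finish

end Maxwell

theorem mainTheorem6 :
    -- the flux defining the presymplectic form is the same through every time slice
    (∀ (t : ℝ) (ζ₁ ζ₂ : Maxwell.solutionSpace),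
      Maxwell.omega ζ₁ ζ₂ = Maxwell.flux t ζ₁ ζ₂) ∧
    -- the Coulomb-gauge representative is what its name says
    (∀ ζ : Maxwell.solutionSpace,
      ContDiff ℝ ∞ (Maxwell.coulombPotential ζ) ∧
      Maxwell.GaugeEquivalent ζ (Maxwell.coulombRep ζ) ∧
      Maxwell.SolvesMaxwell (Maxwell.coulombRep ζ) ∧
      Maxwell.IsCoulombGauge (Maxwell.coulombRep ζ)) ∧
    -- the three equivalent conditions
    (∀ ζ : Maxwell.solutionSpace,
      List.TFAE [
        ζ ∈ LinearMap.ker Maxwell.omega,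
        Maxwell.coulombRep ζ = 0,
        ∃ χ : Maxwell.Spacetime → ℝ, ContDiff ℝ ∞ χ ∧
          (ζ : Maxwell.Spacetime → Fin 4 → ℝ) = Maxwell.gradient χ]) ∧
    -- the reduced space consists of gauge equivalence classes
    (∀ ζ₁ ζ₂ : Maxwell.solutionSpace,
      (Submodule.Quotient.mk ζ₁ : Maxwell.ReducedSpace) = Submodule.Quotient.mk ζ₂ ↔
        Maxwell.GaugeEquivalent ζ₁ ζ₂) := by
  refine ⟨fun t ζ₁ ζ₂ => Maxwell.flux_eq_flux ζ₁ ζ₂ 0 t, fun ζ => ?_,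
    Maxwell.tfae_mem_ker_omega, fun ζ₁ ζ₂ => ?_⟩
  · obtain ⟨hs, hk, hm⟩ := ζ.2
    exact ⟨Maxwell.contDiff_coulombPotential hs hk, Maxwell.gaugeEquivalent_coulombRep hs hk,
      Maxwell.solvesMaxwell_coulombRep hs hk hm, Maxwell.isCoulombGauge_coulombRep hs hk hm⟩
  -- Equality of classes means that `ζ₁ - ζ₂` lies in the kernel, that is, is a gradient.
  · rw [Submodule.Quotient.eq]
    refine ((Maxwell.tfae_mem_ker_omega (ζ₁ - ζ₂)).out 0 2).trans ?_
    simp only [Maxwell.GaugeEquivalent, Submodule.coe_sub, sub_eq_iff_eq_add']
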